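/- Lemma 3.1. There is an absolute constant $C>0$ with the following property. Let $P\ge 3$ and $T\ge 1$ be real, and let $\rho=\beta+i\gamma$ run over a finite family of $N\ge 0$ complex numbers, counted with multiplicity, such that $0\le\beta\le 1$ and $|\gamma|\le T$. Put $$V=\max_{|t|\le T}\ \sum_{\rho}\bigl(1+(1-\beta)\log P\bigr)^{-1}\bigl(1+(\gamma-t)^2(\log P)^2\bigr)^{-1}.$$ Then for arbitrary complex numbers $a_p$ indexed by the primes $p$ with $P\le p\le P^{6/5}$ we have $$\sum_{\rho}P^{\frac52(\beta-1)}\Bigl|\sum_{P\le p\le P^{6/5}}a_p\,p^{-\rho}\Bigr|^2\ \le\ \bigl(1387\,V+C\,N\,T(\log P)^{-4}\bigr)\sum_{P\le p\le P^{6/5}}|a_p|^2p^{-1}.$$ -/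

import Mathlib

/-- The primes `p` in the segment `P ≤ p ≤ P ^ (6 / 5)`. -/
noncomputable def primeSegment (P : ℝ) : Finset ℕ :=
  {p ∈ Finset.Icc ⌈P⌉₊ ⌊P ^ (6 / 5 : ℝ)⌋₊ | p.Prime}

theorem mem_primeSegment {P : ℝ} (hP : 0 ≤ P) {p : ℕ} :
    p ∈ primeSegment P ↔ p.Prime ∧ P ≤ (p : ℝ) ∧ (p : ℝ) ≤ P ^ (6 / 5 : ℝ) := by
  simp only [primeSegment, Finset.mem_filter, Finset.mem_Icc, Nat.ceil_le,
    Nat.le_floor_iff (Real.rpow_nonneg hP _)]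
  tauto

/-- The weighted count, near height `t`, of a finite family of points `ρ = β + iγ`
(a list, so that points may be repeated):
`∑_ρ (1 + (1 - β) log P)⁻¹ (1 + (γ - t)² (log P)²)⁻¹`. -/
noncomputable def weightedCount {N : ℕ} (ρ : Fin N → ℂ) (P t : ℝ) : ℝ :=
  ∑ j, (1 + (1 - (ρ j).re) * Real.log P)⁻¹ *
    (1 + ((ρ j).im - t) ^ 2 * (Real.log P) ^ 2)⁻¹

/-- The maximum `V` of the weighted count over `|t| ≤ T`. -/
noncomputable def maxWeightedCount {N : ℕ} (ρ : Fin N → ℂ) (P T : ℝ) : ℝ :=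
  sSup (weightedCount ρ P '' Set.Icc (-T) T)

/-- The supremum that defines `V` is a maximum, as soon as the range of `t` is nonempty. -/
theorem isGreatest_maxWeightedCount {N : ℕ} (ρ : Fin N → ℂ) (P T : ℝ) (hT : 0 ≤ T) :
    IsGreatest (weightedCount ρ P '' Set.Icc (-T) T) (maxWeightedCount ρ P T) := by
  have hc : Continuous (weightedCount ρ P) := by
    unfold weightedCount
    refine continuous_finsetSum _ fun j _ => continuous_const.mul (Continuous.inv₀ (by fun_prop) ?_)
    intro t
    positivity
  refine (isCompact_Icc.image hc).isGreatest_sSup ?_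
  exact (Set.nonempty_Icc.2 (by linarith)).image _

/-! Write L = log P. By duality it suffices to bound ∑_p p |∑_j c_j x_j(p)|² by Δ ∑_j |c_j|², where
x_j(n) = P^{5/4(β_j-1)} n^{-ρ_j} and Δ is the factor claimed. The terms are nonnegative, so the
primes may be replaced by all integers n with weight n · bump(u) · `selbergMajorant R n`, where u =
5/4 - (log n)/L and R = ⌊P^{11/25}⌋. After expanding the square, Schur's test leaves the row sums of
a Gram matrix.

Up to a unimodular factor, the entry (j, k) is ∑_n n⁻¹ bump(u) e^{-zu} (∑_{d ∣ n} λ_d)² with z = L(2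
- ρ_j - conj ρ_k), so Re z ≥ 0. The majorant has mean value 1/`selbergMass R` ≤ 25/(11 L). Partial
summation gives a main term equal to L/`selbergMass R` times the Laplace transform of the bump at z,
which is at most 610/((1 + Re z)(1 + (Im z)²)) by `norm_integral_bump_mul_exp_le`; and 610 · 25/11 <
1387. The error is O(T R² P^{-9/10}) = O(T P^{-1/50}), absorbed by T L^{-4}. Dropping 1 - β_j from
Re z turns row j into the weighted count at height γ_j, hence at most V. -/

/-! ### Selberg's upper bound sieve -/

section SelbergWeights

open Finset
open scoped ArithmeticFunction.Moebius

theorem hasSum_indicator_factoredNumbers_inv (l : ℕ) :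
    HasSum ((Nat.factoredNumbers l.primeFactors).indicator fun m : ℕ => (m : ℝ)⁻¹)
      (∏ p ∈ l.primeFactors, (1 - (p : ℝ)⁻¹)⁻¹) := by
  let f : ℕ →* ℝ := ⟨⟨fun m => (m : ℝ)⁻¹, by simp⟩, fun a b => by simp [mul_comm]⟩
  have h := (EulerProduct.summable_and_hasSum_factoredNumbers_prod_filter_prime_geometric
    (f := f) (fun {p} hp => by
      have : (1 : ℝ) < p := by exact_mod_cast hp.one_lt
      simpa [f] using inv_lt_one_of_one_lt₀ this) l.primeFactors).2
  rw [Finset.filter_true_of_mem fun p hp => Nat.prime_of_mem_primeFactors hp] at h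
  exact hasSum_subtype_iff_indicator.mp h

/-- An integer with radical l is l times an integer composed of primes of l, and l⁻¹ ∏_{p ∣ l} (1 -
1/p)⁻¹ = 1/φ(l). -/
theorem sum_inv_filter_radical_le {l : ℕ} (hl : Squarefree l) (N : ℕ) :
    ∑ n ∈ Icc 1 N with ∏ p ∈ n.primeFactors, p = l, (n : ℝ)⁻¹ ≤ (Nat.totient l : ℝ)⁻¹ := by
  have hl0 : (l : ℝ) ≠ 0 := by exact_mod_cast hl.ne_zero
  have hφ : (Nat.totient l : ℝ)⁻¹ =
      (l : ℝ)⁻¹ * ∏ p ∈ l.primeFactors, (1 - (p : ℝ)⁻¹)⁻¹ := by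
    have h : (Nat.totient l : ℝ) = l * ∏ p ∈ l.primeFactors, (1 - (p : ℝ)⁻¹) := by
      have h := congrArg (Rat.cast : ℚ → ℝ) (Nat.totient_eq_mul_prod_factors l)
      push_cast at h
      exact h
    rw [h, mul_inv, Finset.prod_inv_distrib]
  set S : Finset ℕ := {n ∈ Icc 1 N | ∏ p ∈ n.primeFactors, p = l}
  have hS : ∀ n ∈ S, n ≠ 0 ∧ l ∣ n ∧ n.primeFactors = l.primeFactors := by
    intro n hn
    obtain ⟨h1, rfl⟩ := Finset.mem_filter.mp hn
    refine ⟨by have := (Finset.mem_Icc.mp h1).1; omega, Nat.prod_primeFactors_dvd n, ?_⟩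
    exact (Nat.primeFactors_prod fun p hp => Nat.prime_of_mem_primeFactors hp).symm
  have hinj : Set.InjOn (fun n => n / l) (S : Set ℕ) := by
    intro a ha b hb hab
    have ha' := Nat.div_mul_cancel (hS a ha).2.1
    have hb' := Nat.div_mul_cancel (hS b hb).2.1
    simp only at hab
    rw [← ha', ← hb', hab]
  have hsum : ∑ n ∈ S, (n : ℝ)⁻¹ = (l : ℝ)⁻¹ * ∑ m ∈ S.image (fun n => n / l),
      (Nat.factoredNumbers l.primeFactors).indicator (fun m : ℕ => (m : ℝ)⁻¹) m := by
    rw [Finset.sum_image hinj, Finset.mul_sum]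
    refine Finset.sum_congr rfl fun n hn => ?_
    obtain ⟨hn0, hln, hpf⟩ := hS n hn
    have hdiv : n / l ≠ 0 := by
      intro h
      have := Nat.div_mul_cancel hln
      rw [h, zero_mul] at this
      exact hn0 this.symm
    rw [Set.indicator_of_mem, Nat.cast_div hln hl0]
    · field_simp
    · rw [Nat.mem_factoredNumbers_iff_primeFactors_subset, ← hpf]
      exact ⟨hdiv, Nat.primeFactors_mono (Nat.div_dvd_of_dvd hln) hn0⟩
  rw [hsum, hφ]
  gcongr
  exact sum_le_hasSum _ (fun m _ => Set.indicator_nonneg (fun _ _ => by positivity) _)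
    (hasSum_indicator_factoredNumbers_inv l)

/-- The squarefree integers in `[1, R]`. -/
def squarefreeUpTo (R : ℕ) : Finset ℕ := {l ∈ Icc 1 R | Squarefree l}

/-- `∑_{l ≤ R} μ(l)² / φ(l)`. -/
noncomputable def selbergMass (R : ℕ) : ℝ := ∑ l ∈ squarefreeUpTo R, (Nat.totient l : ℝ)⁻¹

/-- Selberg's weights `λ_d`, which minimise the main term of the upper bound sieve of level `R²`. -/
noncomputable def selbergWeight (R d : ℕ) : ℝ :=
  (μ d : ℝ) * d * (selbergMass R)⁻¹ *
    ∑ l ∈ squarefreeUpTo R with d ∣ l, (Nat.totient l : ℝ)⁻¹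

theorem mem_squarefreeUpTo {R l : ℕ} :
    l ∈ squarefreeUpTo R ↔ (1 ≤ l ∧ l ≤ R) ∧ Squarefree l := by
  simp [squarefreeUpTo]

/-- Group the harmonic sum up to R by radicals: each radical is squarefree and at most R. -/
theorem log_le_selbergMass (R : ℕ) : Real.log (R + 1) ≤ selbergMass R := by
  have h := log_add_one_le_harmonic R
  rw [harmonic_eq_sum_Icc] at h
  push_cast at h
  refine h.trans ?_
  rw [← Finset.sum_fiberwise_of_maps_to (s := Icc 1 R) (t := squarefreeUpTo R)
    (g := fun n => ∏ p ∈ n.primeFactors, p)]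
  · exact Finset.sum_le_sum fun l hl =>
      sum_inv_filter_radical_le (mem_squarefreeUpTo.mp hl).2 R
  · intro n hn
    rw [Finset.mem_Icc] at hn
    refine mem_squarefreeUpTo.mpr ⟨⟨Nat.pos_of_ne_zero ?_, ?_⟩, ?_⟩
    · exact Finset.prod_ne_zero_iff.mpr fun p hp => (Nat.prime_of_mem_primeFactors hp).ne_zero
    · exact (Nat.le_of_dvd (by omega) (Nat.prod_primeFactors_dvd n)).trans hn.2
    · exact Finset.squarefree_prod_of_pairwise_isCoprime
        (fun p hp q hq hpq => Nat.coprime_iff_isRelPrime.mp <|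
          (Nat.coprime_primes (Nat.prime_of_mem_primeFactors hp)
            (Nat.prime_of_mem_primeFactors hq)).mpr hpq)
        (fun p hp => (Nat.prime_of_mem_primeFactors hp).prime.squarefree)

theorem selbergMass_pos {R : ℕ} (hR : 1 ≤ R) : 0 < selbergMass R := by
  refine Finset.sum_pos (fun l hl => ?_) ⟨1, mem_squarefreeUpTo.mpr ⟨⟨le_rfl, hR⟩, squarefree_one⟩⟩
  have := Nat.totient_pos.mpr (mem_squarefreeUpTo.mp hl).1.1
  positivity

theorem selbergWeight_one {R : ℕ} (hR : 1 ≤ R) : selbergWeight R 1 = 1 := by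
  have := (selbergMass_pos hR).ne'
  simp only [selbergWeight, one_dvd, Finset.filter_true]
  simp only [ArithmeticFunction.moebius_apply_one, Int.cast_one, Nat.cast_one, mul_one, one_mul]
  exact inv_mul_cancel₀ this

theorem selbergWeight_eq_zero_of_lt {R d : ℕ} (h : R < d) : selbergWeight R d = 0 := by
  rw [selbergWeight, Finset.filter_eq_empty_iff.mpr, Finset.sum_empty, mul_zero]
  intro l hl hdl
  have := mem_squarefreeUpTo.mp hl
  have := Nat.le_of_dvd (by omega) hdl
  omega

/-- This gives |λ_d| ≤ 1. Split the mass by k = gcd(l, d), and write d = ∑_{k ∣ d} φ(d/k). With e =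
d/k, dividing a squarefree multiple of d by e yields an integer whose gcd with d is k, and
multiplies 1/φ by φ(e). -/
theorem mul_sum_inv_totient_le_selbergMass {R d : ℕ} (hd : d ≠ 0) :
    (d : ℝ) * ∑ l ∈ squarefreeUpTo R with d ∣ l, (Nat.totient l : ℝ)⁻¹ ≤ selbergMass R := by
  have hgcd : ∀ l ∈ squarefreeUpTo R, l.gcd d ∈ d.divisors := fun l _ =>
    Nat.mem_divisors.mpr ⟨Nat.gcd_dvd_right _ _, hd⟩
  rw [selbergMass, ← Finset.sum_fiberwise_of_maps_to hgcd]
  have hdsum : (d : ℝ) = ∑ k ∈ d.divisors, (Nat.totient k : ℝ) := by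
    exact_mod_cast (Nat.sum_totient d).symm
  have hdsum' : (d : ℝ) = ∑ k ∈ d.divisors, (Nat.totient (d / k) : ℝ) := by
    rw [hdsum, Nat.sum_div_divisors d fun k => (Nat.totient k : ℝ)]
  rw [hdsum', Finset.sum_mul]
  refine Finset.sum_le_sum fun k hk => ?_
  have hkd := (Nat.mem_divisors.mp hk).1
  obtain ⟨e, rfl⟩ := hkd
  have hk0 : 0 < k := Nat.pos_of_ne_zero (left_ne_zero_of_mul hd)
  have he0 : 0 < e := Nat.pos_of_ne_zero (right_ne_zero_of_mul hd)
  rw [Nat.mul_div_cancel_left e hk0, Finset.mul_sum]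
  set U : Finset ℕ := {l ∈ squarefreeUpTo R | k * e ∣ l}
  have hinj : Set.InjOn (fun l => l / e) (U : Set ℕ) := by
    intro a ha b hb hab
    have h1 : e ∣ a := (dvd_mul_left e k).trans (Finset.mem_filter.mp ha).2
    have h2 : e ∣ b := (dvd_mul_left e k).trans (Finset.mem_filter.mp hb).2
    simp only at hab
    rw [← Nat.div_mul_cancel h1, ← Nat.div_mul_cancel h2, hab]
  have hterm : ∀ l ∈ U, (Nat.totient e : ℝ) * (Nat.totient l : ℝ)⁻¹ =
      (Nat.totient (l / e) : ℝ)⁻¹ := by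
    intro l hl
    obtain ⟨hl1, m, rfl⟩ := Finset.mem_filter.mp hl
    have hsq := (mem_squarefreeUpTo.mp hl1).2
    have hrw : k * e * m = e * (k * m) := by ring
    rw [hrw] at hsq ⊢
    have hcop := (Nat.squarefree_mul_iff.mp hsq).1
    rw [Nat.mul_div_cancel_left _ he0, Nat.totient_mul hcop]
    have : (Nat.totient e : ℝ) ≠ 0 := by exact_mod_cast (Nat.totient_pos.mpr he0).ne'
    push_cast
    field_simp
  rw [Finset.sum_congr rfl hterm, ← Finset.sum_image (f := fun m : ℕ => (Nat.totient m : ℝ)⁻¹) hinj]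
  refine Finset.sum_le_sum_of_subset_of_nonneg ?_ fun _ _ _ => by positivity
  intro x hx
  obtain ⟨l, hl, rfl⟩ := Finset.mem_image.mp hx
  obtain ⟨hl1, m, rfl⟩ := Finset.mem_filter.mp hl
  have hrw : k * e * m = e * (k * m) := by ring
  rw [hrw] at hl1 ⊢
  obtain ⟨⟨h1, h2⟩, hsq⟩ := mem_squarefreeUpTo.mp hl1
  obtain ⟨hcop, -, hsq'⟩ := Nat.squarefree_mul_iff.mp hsq
  simp only [Nat.mul_div_cancel_left _ he0]
  refine Finset.mem_filter.mpr ⟨mem_squarefreeUpTo.mpr ⟨⟨?_, ?_⟩, hsq'⟩, ?_⟩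
  · exact Nat.pos_of_ne_zero hsq'.ne_zero
  · exact (Nat.le_mul_of_pos_left _ he0).trans h2
  · rw [Nat.gcd_mul_left, Nat.Coprime.gcd_eq_one, mul_one]
    exact (Nat.Coprime.coprime_mul_left_right hcop).symm

theorem abs_selbergWeight_le_one (R d : ℕ) : |selbergWeight R d| ≤ 1 := by
  rcases Nat.eq_zero_or_pos d with rfl | hd
  · simp [selbergWeight]
  rcases lt_or_ge R d with h | h
  · simp [selbergWeight_eq_zero_of_lt h]
  have hm := selbergMass_pos (hd.trans_le h)
  have h1 := mul_sum_inv_totient_le_selbergMass (R := R) hd.ne'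
  have hμ : |(μ d : ℝ)| ≤ 1 := by exact_mod_cast ArithmeticFunction.abs_moebius_le_one (n := d)
  set s := ∑ l ∈ squarefreeUpTo R with d ∣ l, (Nat.totient l : ℝ)⁻¹
  have hs : 0 ≤ s := Finset.sum_nonneg fun _ _ => by positivity
  have : selbergWeight R d = μ d * ((selbergMass R)⁻¹ * (d * s)) := by
    simp only [selbergWeight, s]; ring
  rw [this, abs_mul, abs_of_nonneg (a := (selbergMass R)⁻¹ * (d * s)) (by positivity)]
  have : (selbergMass R)⁻¹ * (d * s) ≤ 1 := by
    rw [inv_mul_le_one₀ hm]; exact h1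
  exact mul_le_one₀ hμ (by positivity) this

theorem sum_moebius_filter_dvd {m l R : ℕ} (hm : m ∈ squarefreeUpTo R) (hl : l ∣ m) :
    ∑ d ∈ Icc 1 R with l ∣ d ∧ d ∣ m, (μ d : ℝ) = if m = l then (μ l : ℝ) else 0 := by
  obtain ⟨⟨hm1, hmR⟩, hsq⟩ := mem_squarefreeUpTo.mp hm
  obtain ⟨k, rfl⟩ := hl
  have hl0 : 0 < l := Nat.pos_of_ne_zero (left_ne_zero_of_mul hsq.ne_zero)
  have hk0 : 0 < k := Nat.pos_of_ne_zero (right_ne_zero_of_mul hsq.ne_zero)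
  have hset : {d ∈ Icc 1 R | l ∣ d ∧ d ∣ l * k} = k.divisors.image (l * ·) := by
    ext d
    simp only [Finset.mem_filter, Finset.mem_Icc, Finset.mem_image, Nat.mem_divisors]
    constructor
    · rintro ⟨-, ⟨e, rfl⟩, h⟩
      exact ⟨e, ⟨Nat.dvd_of_mul_dvd_mul_left hl0 h, hk0.ne'⟩, rfl⟩
    · rintro ⟨e, ⟨he, -⟩, rfl⟩
      have he0 : 0 < e := Nat.pos_of_dvd_of_pos he hk0
      have hd := Nat.mul_dvd_mul_left l he
      exact ⟨⟨Nat.mul_pos hl0 he0, (Nat.le_of_dvd (by omega) hd).trans hmR⟩, dvd_mul_right _ _, hd⟩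
  rw [hset, Finset.sum_image fun a _ b _ h => Nat.eq_of_mul_eq_mul_left hl0 h]
  have hcop : ∀ e ∈ k.divisors, (μ (l * e) : ℝ) = μ l * μ e := by
    intro e he
    have hc := (Nat.squarefree_mul_iff.mp hsq).1.coprime_dvd_right (Nat.mem_divisors.mp he).1
    exact_mod_cast ArithmeticFunction.isMultiplicative_moebius.map_mul_of_coprime hc
  rw [Finset.sum_congr rfl hcop, ← Finset.mul_sum]
  have hμ : ∑ e ∈ k.divisors, (μ e : ℝ) = if k = 1 then 1 else 0 := by
    have h := congrArg (fun f => f k) ArithmeticFunction.moebius_mul_coe_zeta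
    simp only [ArithmeticFunction.coe_mul_zeta_apply, ArithmeticFunction.one_apply] at h
    exact_mod_cast h
  have hiff : l * k = l ↔ k = 1 := by
    rw [Nat.mul_eq_left hl0.ne']
  simp only [hμ, hiff]
  split_ifs <;> simp

/-- Möbius inversion: these sums are the variables in which the quadratic form of the sieve is
diagonal. -/
theorem sum_selbergWeight_div {R l : ℕ} (hl : l ∈ Icc 1 R) :
    ∑ d ∈ Icc 1 R with l ∣ d, selbergWeight R d / d =
      (μ l : ℝ) * (Nat.totient l : ℝ)⁻¹ * (selbergMass R)⁻¹ := by
  have h1 : ∀ d ∈ (Icc 1 R).filter (l ∣ ·), selbergWeight R d / d =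
      ∑ m ∈ squarefreeUpTo R, (selbergMass R)⁻¹ * (Nat.totient m : ℝ)⁻¹ *
        if d ∣ m then (μ d : ℝ) else 0 := by
    intro d hd
    have hd0 : (d : ℝ) ≠ 0 := by
      have := (Finset.mem_Icc.mp (Finset.mem_filter.mp hd).1).1
      exact_mod_cast (by omega : d ≠ 0)
    rw [selbergWeight, Finset.sum_filter, Finset.mul_sum, Finset.sum_div]
    refine Finset.sum_congr rfl fun m _ => ?_
    split_ifs
    · field_simp
    · simp
  rw [Finset.sum_congr rfl h1, Finset.sum_comm]
  have h2 : ∀ m ∈ squarefreeUpTo R,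
      ∑ d ∈ Icc 1 R with l ∣ d, (selbergMass R)⁻¹ * (Nat.totient m : ℝ)⁻¹ *
        (if d ∣ m then (μ d : ℝ) else 0) =
      if m = l then (μ l : ℝ) * (Nat.totient l : ℝ)⁻¹ * (selbergMass R)⁻¹ else 0 := by
    intro m hm
    rw [← Finset.mul_sum, ← Finset.sum_filter, Finset.filter_filter]
    by_cases hlm : l ∣ m
    · rw [sum_moebius_filter_dvd hm hlm]
      split_ifs with h
      · subst h; ring
      · simp
    · rw [Finset.filter_eq_empty_iff.mpr, Finset.sum_empty, mul_zero, if_neg]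
      · rintro rfl; exact hlm dvd_rfl
      · rintro d - ⟨h3, h4⟩; exact hlm (h3.trans h4)
  rw [Finset.sum_congr rfl h2, Finset.sum_ite_eq']
  split_ifs with h
  · rfl
  · have : ¬ Squarefree l := fun hs => h (mem_squarefreeUpTo.mpr ⟨Finset.mem_Icc.mp hl, hs⟩)
    simp [ArithmeticFunction.moebius_eq_zero_of_not_squarefree this]

/-- Since 1/lcm(d, e) = gcd(d, e)/(de) and gcd(d, e) = ∑_{l ∣ d, l ∣ e} φ(l), the form becomes a sum
of squares weighted by φ(l). -/
theorem sum_selbergWeight_mul_div_lcm {R : ℕ} (hR : 1 ≤ R) :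
    ∑ d ∈ Icc 1 R, ∑ e ∈ Icc 1 R, selbergWeight R d * selbergWeight R e / (d.lcm e : ℝ) =
      (selbergMass R)⁻¹ := by
  have hterm : ∀ d ∈ Icc 1 R, ∀ e ∈ Icc 1 R,
      selbergWeight R d * selbergWeight R e / (d.lcm e : ℝ) =
      ∑ l ∈ Icc 1 R, (Nat.totient l : ℝ) * ((if l ∣ d then selbergWeight R d / d else 0) *
        (if l ∣ e then selbergWeight R e / e else 0)) := by
    intro d hd e he
    rw [Finset.mem_Icc] at hd he
    have hd0 : (d : ℝ) ≠ 0 := by exact_mod_cast (by omega : d ≠ 0)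
    have he0 : (e : ℝ) ≠ 0 := by exact_mod_cast (by omega : e ≠ 0)
    have hlcm : (d.lcm e : ℝ) ≠ 0 := by
      exact_mod_cast Nat.lcm_ne_zero (by omega) (by omega)
    have hgl : (d.gcd e : ℝ) * d.lcm e = d * e := by exact_mod_cast Nat.gcd_mul_lcm d e
    have hg : (d.gcd e : ℝ) = ∑ l ∈ Icc 1 R, if l ∣ d ∧ l ∣ e then (Nat.totient l : ℝ) else 0 := by
      rw [← Finset.sum_filter]
      have hset : {l ∈ Icc 1 R | l ∣ d ∧ l ∣ e} = (d.gcd e).divisors := by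
        ext l
        simp only [Finset.mem_filter, Finset.mem_Icc, Nat.mem_divisors, Nat.dvd_gcd_iff]
        constructor
        · rintro ⟨-, h⟩
          exact ⟨h, (Nat.gcd_pos_of_pos_left e (by omega)).ne'⟩
        · rintro ⟨h, -⟩
          exact ⟨⟨Nat.pos_of_dvd_of_pos h.1 (by omega),
            (Nat.le_of_dvd (by omega) h.1).trans hd.2⟩, h⟩
      rw [hset]
      exact_mod_cast (Nat.sum_totient (d.gcd e)).symm
    have : selbergWeight R d * selbergWeight R e / (d.lcm e : ℝ) =
        (d.gcd e : ℝ) * (selbergWeight R d / d * (selbergWeight R e / e)) := by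
      field_simp
      linear_combination (-selbergWeight R d * selbergWeight R e) * hgl
    rw [this, hg, Finset.sum_mul]
    refine Finset.sum_congr rfl fun l _ => ?_
    by_cases h1 : l ∣ d <;> by_cases h2 : l ∣ e <;> simp [h1, h2]
  have hm := selbergMass_pos hR
  calc _ = ∑ d ∈ Icc 1 R, ∑ e ∈ Icc 1 R, ∑ l ∈ Icc 1 R, (Nat.totient l : ℝ) *
        ((if l ∣ d then selbergWeight R d / d else 0) *
          (if l ∣ e then selbergWeight R e / e else 0)) :=
        Finset.sum_congr rfl fun d hd => Finset.sum_congr rfl fun e he => hterm d hd e he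
    _ = ∑ l ∈ Icc 1 R, (Nat.totient l : ℝ) *
        (∑ d ∈ Icc 1 R with l ∣ d, selbergWeight R d / d) ^ 2 := by
        rw [Finset.sum_congr rfl fun d _ => Finset.sum_comm, Finset.sum_comm]
        refine Finset.sum_congr rfl fun l _ => ?_
        rw [Finset.sum_filter, sq, Finset.sum_mul_sum, Finset.mul_sum]
        exact Finset.sum_congr rfl fun d _ => (Finset.mul_sum _ _ _).symm
    _ = ∑ l ∈ Icc 1 R, (selbergMass R)⁻¹ ^ 2 *
          if Squarefree l then (Nat.totient l : ℝ)⁻¹ else 0 := by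
        refine Finset.sum_congr rfl fun l hl => ?_
        rw [sum_selbergWeight_div hl]
        have : (Nat.totient l : ℝ) ≠ 0 := by
          exact_mod_cast (Nat.totient_pos.mpr (Finset.mem_Icc.mp hl).1).ne'
        split_ifs with h
        · have hμ : (μ l : ℝ) ^ 2 = 1 := by
            exact_mod_cast ArithmeticFunction.moebius_sq_eq_one_of_squarefree h
          field_simp
          linear_combination hμ
        · simp [ArithmeticFunction.moebius_eq_zero_of_not_squarefree h]
    _ = (selbergMass R)⁻¹ := by
        rw [← Finset.mul_sum, ← Finset.sum_filter]
        change (selbergMass R)⁻¹ ^ 2 * selbergMass R = _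
        field_simp

/-- The Selberg majorant `(∑_{d ∣ n} λ_d)²` of the indicator of integers free of prime factors
at most `R`. -/
noncomputable def selbergMajorant (R n : ℕ) : ℝ := (∑ d ∈ n.divisors, selbergWeight R d) ^ 2

theorem selbergMajorant_nonneg (R n : ℕ) : 0 ≤ selbergMajorant R n := sq_nonneg _

theorem selbergMajorant_prime {R p : ℕ} (hR : 1 ≤ R) (hp : p.Prime) (hRp : R < p) :
    selbergMajorant R p = 1 := by
  rw [selbergMajorant, hp.sum_divisors, selbergWeight_eq_zero_of_lt hRp, selbergWeight_one hR]
  norm_num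

/-- Each of the R² pairs (d, e) replaces a floor by its argument, at a cost of at most 1 because
|λ_d λ_e| ≤ 1. -/
theorem abs_sum_selbergMajorant_sub_le {R : ℕ} (hR : 1 ≤ R) {x : ℝ} (hx : 0 ≤ x) :
    |∑ n ∈ Icc 0 ⌊x⌋₊, selbergMajorant R n - (selbergMass R)⁻¹ * x| ≤ (R : ℝ) ^ 2 := by
  have hexp : ∑ n ∈ Icc 0 ⌊x⌋₊, selbergMajorant R n =
      ∑ d ∈ Icc 1 R, ∑ e ∈ Icc 1 R, selbergWeight R d * selbergWeight R e *
        ((⌊x⌋₊ / d.lcm e : ℕ) : ℝ) := by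
    -- The term n = 0 vanishes because `Nat.divisors 0` is empty.
    have h0 : ∑ n ∈ Icc 0 ⌊x⌋₊, selbergMajorant R n = ∑ n ∈ Ioc 0 ⌊x⌋₊, selbergMajorant R n := by
      refine (Finset.sum_subset (fun n hn => ?_) fun n _ hn' => ?_).symm
      · simp only [Finset.mem_Ioc, Finset.mem_Icc] at hn ⊢; omega
      · have : n = 0 := by
          simp only [Finset.mem_Ioc, Finset.mem_Icc] at *; omega
        simp [this, selbergMajorant]
    have h1 : ∀ n ∈ Ioc 0 ⌊x⌋₊, selbergMajorant R n =
        ∑ d ∈ Icc 1 R, ∑ e ∈ Icc 1 R, if d.lcm e ∣ n then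
          selbergWeight R d * selbergWeight R e else 0 := by
      intro n hn
      have hn0 : n ≠ 0 := by have := (Finset.mem_Ioc.mp hn).1; omega
      have h2 : ∑ d ∈ n.divisors, selbergWeight R d =
          ∑ d ∈ Icc 1 R, if d ∣ n then selbergWeight R d else 0 := by
        rw [← Finset.sum_filter]
        refine (Finset.sum_subset (fun d hd => ?_) fun d hd hd' => ?_).symm
        · exact Nat.mem_divisors.mpr ⟨(Finset.mem_filter.mp hd).2, hn0⟩
        · refine selbergWeight_eq_zero_of_lt ?_
          by_contra hlt
          refine hd' (Finset.mem_filter.mpr ⟨Finset.mem_Icc.mpr ⟨Nat.pos_of_mem_divisors hd, by omega⟩,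
            Nat.dvd_of_mem_divisors hd⟩)
      rw [selbergMajorant, h2, sq, Finset.sum_mul_sum]
      refine Finset.sum_congr rfl fun d _ => Finset.sum_congr rfl fun e _ => ?_
      by_cases h3 : d ∣ n <;> by_cases h4 : e ∣ n <;> simp [h3, h4, Nat.lcm_dvd_iff]
    rw [h0, Finset.sum_congr rfl h1, Finset.sum_comm]
    refine Finset.sum_congr rfl fun d _ => ?_
    rw [Finset.sum_comm]
    refine Finset.sum_congr rfl fun e _ => ?_
    rw [← Finset.sum_filter, Finset.sum_const, Nat.Ioc_filter_dvd_card_eq_div, nsmul_eq_mul, mul_comm]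
  rw [hexp, ← sum_selbergWeight_mul_div_lcm hR, Finset.sum_mul, ← Finset.sum_sub_distrib]
  have hbound : ∀ d ∈ Icc 1 R, ∀ e ∈ Icc 1 R,
      |selbergWeight R d * selbergWeight R e * ((⌊x⌋₊ / d.lcm e : ℕ) : ℝ) -
        selbergWeight R d * selbergWeight R e / (d.lcm e : ℝ) * x| ≤ 1 := by
    intro d _ e _
    have h1 : selbergWeight R d * selbergWeight R e * ((⌊x⌋₊ / d.lcm e : ℕ) : ℝ) -
        selbergWeight R d * selbergWeight R e / (d.lcm e : ℝ) * x =
        selbergWeight R d * (selbergWeight R e *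
          (((⌊x⌋₊ / d.lcm e : ℕ) : ℝ) - x / (d.lcm e : ℝ))) := by ring
    have h2 : |((⌊x⌋₊ / d.lcm e : ℕ) : ℝ) - x / (d.lcm e : ℝ)| ≤ 1 := by
      rw [← Nat.floor_div_natCast, abs_le]
      have h3 := Nat.floor_le (a := x / (d.lcm e : ℝ)) (by positivity)
      have h4 := Nat.lt_floor_add_one (x / (d.lcm e : ℝ))
      constructor <;> linarith
    rw [h1, abs_mul, abs_mul]
    exact mul_le_one₀ (abs_selbergWeight_le_one R d) (by positivity)
      (mul_le_one₀ (abs_selbergWeight_le_one R e) (by positivity) h2)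
  calc _ ≤ ∑ d ∈ Icc 1 R, ∑ e ∈ Icc 1 R, (1 : ℝ) := by
        refine (Finset.abs_sum_le_sum_abs _ _).trans (Finset.sum_le_sum fun d hd => ?_)
        rw [Finset.sum_mul, ← Finset.sum_sub_distrib]
        exact (Finset.abs_sum_le_sum_abs _ _).trans (Finset.sum_le_sum fun e he => hbound d hd e he)
    _ = (R : ℝ) ^ 2 := by simp [sq]

end SelbergWeights

/-! ### The bump function and its Laplace transform -/

section LaplaceTransform

open Complex MeasureTheory intervalIntegral

theorem hasDerivAt_max_zero_sq (x : ℝ) :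
    HasDerivAt (fun y : ℝ => max y 0 ^ 2) (2 * max x 0) x := by
  rcases lt_trichotomy x 0 with h | rfl | h
  · rw [max_eq_right h.le, mul_zero]
    refine (hasDerivAt_const x (0 : ℝ)).congr_of_eventuallyEq ?_
    filter_upwards [gt_mem_nhds h] with y hy
    simp [max_eq_right hy.le]
  · rw [max_self, mul_zero, hasDerivAt_iff_hasFDerivAt]
    have : (ContinuousLinearMap.toSpanSingleton ℝ (0 : ℝ)) = 0 := by ext; simp
    rw [this]
    -- At the corner the function is O(y²), which forces derivative 0.
    refine Asymptotics.IsBigO.hasFDerivAt (n := 2) ?_ one_lt_two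
    refine Asymptotics.IsBigO.of_norm_le fun y => ?_
    have h0 : 0 ≤ max y 0 := le_max_right y 0
    have h1 : max y 0 ≤ |y| := max_le (le_abs_self y) (abs_nonneg y)
    rw [sub_zero, norm_pow, Real.norm_eq_abs, Real.norm_eq_abs, abs_of_nonneg h0]
    gcongr
  · rw [max_eq_left h.le]
    have h1 : HasDerivAt (fun y : ℝ => y ^ 2) (2 * x) x := by simpa using hasDerivAt_pow 2 x
    refine h1.congr_of_eventuallyEq ?_
    filter_upwards [lt_mem_nhds h] with y hy
    simp [max_eq_left hy.le]

/-- A quadratic spline supported in `[0, 7/20]`, proportional to the convolution of the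
indicators of `[0, 1/20]`, `[0, 3/20]` and `[0, 3/20]`. -/
noncomputable def bump (u : ℝ) : ℝ :=
  400 * (max u 0 ^ 2 - max (u - 1 / 20) 0 ^ 2 - 2 * max (u - 3 / 20) 0 ^ 2 +
    2 * max (u - 4 / 20) 0 ^ 2 + max (u - 6 / 20) 0 ^ 2 - max (u - 7 / 20) 0 ^ 2)

/-- The derivative of `bump`. -/
noncomputable def bumpDeriv (u : ℝ) : ℝ :=
  800 * (max u 0 - max (u - 1 / 20) 0 - 2 * max (u - 3 / 20) 0 +
    2 * max (u - 4 / 20) 0 + max (u - 6 / 20) 0 - max (u - 7 / 20) 0)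

theorem hasDerivAt_bump (u : ℝ) : HasDerivAt bump (bumpDeriv u) u := by
  have h (b : ℝ) : HasDerivAt (fun y : ℝ => max (y - b) 0 ^ 2) (2 * max (u - b) 0) u :=
    (hasDerivAt_max_zero_sq (u - b)).comp_sub_const u b
  have := ((((((hasDerivAt_max_zero_sq u).sub (h (1 / 20))).sub ((h (3 / 20)).const_mul 2)).add
    ((h (4 / 20)).const_mul 2)).add (h (6 / 20))).sub (h (7 / 20))).const_mul 400
  refine this.congr_deriv ?_
  rw [bumpDeriv]
  ring

theorem continuous_bump : Continuous bump := by unfold bump; fun_prop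

theorem continuous_bumpDeriv : Continuous bumpDeriv := by unfold bumpDeriv; fun_prop

theorem bump_eq_of_nonpos {u : ℝ} (h : u ≤ 0) : bump u = 0 := by
  rw [bump, max_eq_right (by linarith), max_eq_right (by linarith), max_eq_right (by linarith),
    max_eq_right (by linarith), max_eq_right (by linarith), max_eq_right (by linarith)]
  norm_num

theorem bump_eq_of_ge {u : ℝ} (h : 7 / 20 ≤ u) : bump u = 0 := by
  rw [bump, max_eq_left (by linarith), max_eq_left (by linarith), max_eq_left (by linarith),
    max_eq_left (by linarith), max_eq_left (by linarith), max_eq_left (by linarith)]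
  ring

/-- The factor 400 makes the bump equal to 1 at u = 1/20 and u = 6/20. The upper bound 7 is crude
and affects only the error constant. -/
theorem bump_bounds (u : ℝ) :
    0 ≤ bump u ∧ bump u ≤ 7 ∧ (1 / 20 ≤ u → u ≤ 6 / 20 → 1 ≤ bump u) := by
  rcases le_total u 0 with h | h0
  · rw [bump_eq_of_nonpos h]
    exact ⟨le_rfl, by norm_num, fun _ _ => by linarith⟩
  rcases le_total (7 / 20) u with h | h7
  · rw [bump_eq_of_ge h]
    exact ⟨le_rfl, by norm_num, fun _ _ => by linarith⟩
  rw [bump, max_eq_left h0, max_eq_right (a := u - 7 / 20) (by linarith)]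
  rcases le_total u (1 / 20) with h | h1
  · rw [max_eq_right (by linarith), max_eq_right (by linarith), max_eq_right (by linarith),
      max_eq_right (by linarith)]
    exact ⟨by nlinarith, by nlinarith, fun _ _ => by nlinarith⟩
  rw [max_eq_left (a := u - 1 / 20) (by linarith)]
  rcases le_total u (3 / 20) with h | h2
  · rw [max_eq_right (by linarith), max_eq_right (by linarith), max_eq_right (by linarith)]
    exact ⟨by nlinarith, by nlinarith, fun _ _ => by nlinarith⟩
  rw [max_eq_left (a := u - 3 / 20) (by linarith)]
  rcases le_total u (4 / 20) with h | h3
  · rw [max_eq_right (by linarith), max_eq_right (by linarith)]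
    exact ⟨by nlinarith, by nlinarith, fun _ _ => by nlinarith⟩
  rw [max_eq_left (a := u - 4 / 20) (by linarith)]
  rcases le_total u (6 / 20) with h | h4
  · rw [max_eq_right (by linarith)]
    exact ⟨by nlinarith, by nlinarith, fun _ _ => by nlinarith⟩
  rw [max_eq_left (a := u - 6 / 20) (by linarith)]
  exact ⟨by nlinarith, by nlinarith, fun _ _ => by nlinarith⟩

theorem integral_max_sub_sq_mul_exp {z : ℂ} (hz : z ≠ 0) {b S : ℝ} (hb : 0 ≤ b) (hbS : b ≤ S) :
    ∫ u in (0 : ℝ)..S, ((max (u - b) 0 ^ 2 : ℝ) : ℂ) * exp (-(z * u)) =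
      2 * exp (-(z * b)) / z ^ 3 - exp (-(z * S)) *
        ((S - b) ^ 2 / z + 2 * (S - b) / z ^ 2 + 2 / z ^ 3) := by
  have hc : Continuous fun u : ℝ => ((max (u - b) 0 ^ 2 : ℝ) : ℂ) * exp (-(z * u)) := by fun_prop
  rw [← integral_add_adjacent_intervals (hc.intervalIntegrable 0 b) (hc.intervalIntegrable b S)]
  have h1 : ∫ u in (0 : ℝ)..b, ((max (u - b) 0 ^ 2 : ℝ) : ℂ) * exp (-(z * u)) = 0 := by
    rw [integral_congr (g := fun _ => (0 : ℂ)), intervalIntegral.integral_zero]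
    intro u hu
    rw [Set.uIcc_of_le hb] at hu
    simp [max_eq_right (show u - b ≤ 0 by linarith [hu.2])]
  have h2 : ∫ u in b..S, ((max (u - b) 0 ^ 2 : ℝ) : ℂ) * exp (-(z * u)) =
      ∫ u in b..S, ((u : ℂ) - b) ^ 2 * exp (-(z * u)) := by
    refine integral_congr fun u hu => ?_
    rw [Set.uIcc_of_le hbS] at hu
    rw [max_eq_left (show 0 ≤ u - b by linarith [hu.1])]
    push_cast
    rfl
  have hderiv : ∀ u ∈ Set.uIcc b S, HasDerivAt
      (fun u : ℝ => -(((u : ℂ) - b) ^ 2 / z + 2 * (u - b) / z ^ 2 + 2 / z ^ 3) * exp (-(z * u)))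
      (((u : ℂ) - b) ^ 2 * exp (-(z * u))) u := by
    intro u _
    have hid : HasDerivAt (fun u : ℝ => (u : ℂ)) 1 u := Complex.ofRealCLM.hasDerivAt
    have hs := hid.sub_const (b : ℂ)
    have he := ((hid.const_mul z).neg).cexp
    have hp := (((hs.pow 2).div_const z).add ((hs.const_mul 2).div_const (z ^ 2))).add_const
      (2 / z ^ 3)
    refine (hp.neg.mul he).congr_deriv ?_
    simp only [Pi.add_apply, Pi.neg_apply, Pi.pow_apply]
    field_simp
    ring
  have hci : IntervalIntegrable (fun u : ℝ => ((u : ℂ) - b) ^ 2 * exp (-(z * u))) volume b S :=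
    Continuous.intervalIntegrable (by fun_prop) _ _
  rw [h1, h2, integral_eq_sub_of_hasDerivAt hderiv hci, zero_add]
  field_simp
  ring

/-- With q = e^{-z/20}, the knots contribute 1 - q - 2q³ + 2q⁴ + q⁶ - q⁷ = (1 - q)(1 - q³)². The
endpoint terms at 7/20 cancel since the bump and its derivative vanish there and the six
coefficients sum to 0. -/
theorem integral_bump_mul_exp {z : ℂ} (hz : z ≠ 0) :
    ∫ u in (0 : ℝ)..(7 / 20), (bump u : ℂ) * exp (-(z * u)) =
      800 * (1 - exp (-(z * (1 / 20)))) * (1 - exp (-(z * (3 / 20)))) ^ 2 / z ^ 3 := by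
  let b : Fin 6 → ℕ := ![0, 1, 3, 4, 6, 7]
  let c : Fin 6 → ℂ := ![400, -400, -800, 800, 400, -400]
  have hsplit : ∀ u : ℝ, (bump u : ℂ) * exp (-(z * u)) =
      ∑ i, c i * (((max (u - (b i : ℝ) / 20) 0 ^ 2 : ℝ) : ℂ) * exp (-(z * u))) := by
    intro u
    simp only [b, c, bump, Fin.sum_univ_six, Matrix.cons_val]
    push_cast
    rw [zero_div, sub_zero]
    ring
  have hb : ∀ i, b i ≤ 7 := by decide
  simp_rw [hsplit]
  rw [intervalIntegral.integral_finsetSum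
    fun i _ => Continuous.intervalIntegrable (by fun_prop) _ _]
  set q := exp (-(z * (1 / 20))) with hq
  have hqk (k : ℕ) : exp (-(z * (k / 20))) = q ^ k := by
    rw [hq, ← Complex.exp_nat_mul]
    congr 1
    ring
  have hterm : ∀ i, ∫ u in (0 : ℝ)..(7 / 20),
      c i * (((max (u - (b i : ℝ) / 20) 0 ^ 2 : ℝ) : ℂ) * exp (-(z * u))) =
      c i * (2 * q ^ b i / z ^ 3 - q ^ 7 *
        ((7 / 20 - b i / 20) ^ 2 / z + 2 * (7 / 20 - b i / 20) / z ^ 2 + 2 / z ^ 3)) := by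
    intro i
    have hi : (b i : ℝ) ≤ 7 := by exact_mod_cast hb i
    rw [intervalIntegral.integral_const_mul,
      integral_max_sub_sq_mul_exp hz (by positivity) (by linarith), ← hqk, ← hqk]
    push_cast
    rfl
  have h3 : exp (-(z * (3 / 20))) = q ^ 3 := by exact_mod_cast hqk 3
  rw [Finset.sum_congr rfl fun i _ => hterm i, h3]
  clear_value q
  simp only [b, c, Fin.sum_univ_six, Matrix.cons_val]
  push_cast
  field_simp
  ring

/-- Here 1 - e^{-zw} = z ∫₀^w e^{-zs} ds. The estimates that follow serve different ranges of z. -/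
theorem norm_one_sub_exp_neg_mul_le (z : ℂ) {w : ℝ} (hw : 0 ≤ w) :
    ‖1 - exp (-(z * w))‖ ≤ ‖z‖ * ∫ s in (0 : ℝ)..w, Real.exp (-(z.re * s)) := by
  have hderiv : ∀ u ∈ Set.uIcc 0 w, HasDerivAt (fun u : ℝ => -exp (-(z * u)))
      (z * exp (-(z * u))) u := by
    intro u _
    have hid : HasDerivAt (fun u : ℝ => (u : ℂ)) 1 u := Complex.ofRealCLM.hasDerivAt
    refine (((hid.const_mul z).neg).cexp.neg).congr_deriv ?_
    simp only [Pi.neg_apply]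
    ring
  have h := integral_eq_sub_of_hasDerivAt hderiv
    (Continuous.intervalIntegrable (by fun_prop) _ _)
  have h' : 1 - exp (-(z * w)) = z * ∫ u in (0 : ℝ)..w, exp (-(z * u)) := by
    rw [← intervalIntegral.integral_const_mul, h]
    simp
    ring
  rw [h', norm_mul]
  gcongr
  refine (intervalIntegral.norm_integral_le_integral_norm hw).trans_eq ?_
  simp [Complex.norm_exp]

theorem norm_one_sub_exp_neg_mul_le_mul {z : ℂ} (hz : 0 ≤ z.re) {w : ℝ} (hw : 0 ≤ w) :
    ‖1 - exp (-(z * w))‖ ≤ ‖z‖ * w := by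
  refine (norm_one_sub_exp_neg_mul_le z hw).trans ?_
  gcongr
  calc ∫ s in (0 : ℝ)..w, Real.exp (-(z.re * s)) ≤ ∫ s in (0 : ℝ)..w, (1 : ℝ) := by
        refine integral_mono_on hw (Continuous.intervalIntegrable (by fun_prop) _ _)
          (by simp) fun s hs => ?_
        rw [Real.exp_le_one_iff]
        have := mul_nonneg hz hs.1
        linarith
    _ = w := by simp

theorem norm_one_sub_exp_neg_mul_le_div {z : ℂ} (hz : 0 < z.re) {w : ℝ} (hw : 0 ≤ w) :
    ‖1 - exp (-(z * w))‖ ≤ ‖z‖ * ((1 - Real.exp (-(z.re * w))) / z.re) := by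
  refine (norm_one_sub_exp_neg_mul_le z hw).trans_eq ?_
  have hderiv : ∀ u ∈ Set.uIcc 0 w, HasDerivAt (fun u : ℝ => -Real.exp (-(z.re * u)) / z.re)
      (Real.exp (-(z.re * u))) u := by
    intro u _
    refine (((((hasDerivAt_id u).const_mul z.re).neg).exp.neg).div_const z.re).congr_deriv ?_
    simp only [Pi.neg_apply, id]
    field_simp
  rw [integral_eq_sub_of_hasDerivAt hderiv (Continuous.intervalIntegrable (by fun_prop) _ _)]
  simp only [mul_zero, neg_zero, Real.exp_zero]
  ring

theorem norm_one_sub_exp_neg_mul_le_one_add (z : ℂ) (w : ℝ) :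
    ‖1 - exp (-(z * w))‖ ≤ 1 + Real.exp (-(z.re * w)) := by
  refine (norm_sub_le _ _).trans_eq ?_
  simp [Complex.norm_exp]

/-- Here |1 - e^{-zw}| ≤ 1 + e^{-w Re z} suffices; in the application A = Re z, B = Im z, ρ = |z|
and r = e^{-A/20}. -/
theorem laplace_bound_of_large_re {A B ρ r : ℝ} (hA : 18 ≤ A) (hρ : 0 ≤ ρ)
    (hρ2 : ρ ^ 2 = A ^ 2 + B ^ 2) (hr : 0 ≤ r) (hr' : r ≤ 2 / 5) :
    (1 + A) * (1 + B ^ 2) * (800 * (1 + r) * (1 + r ^ 3) ^ 2) ≤ 610 * ρ ^ 3 := by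
  have h1 : (1 + r) * (1 + r ^ 3) ^ 2 ≤ (1 + 2 / 5) * (1 + (2 / 5) ^ 3) ^ 2 := by gcongr
  have h2 : (1 + A) * (1 + B ^ 2) ≤ 19 / 18 * A * (ρ ^ 2 - 99 / 100 * A ^ 2) := by
    have : 1 + B ^ 2 ≤ ρ ^ 2 - 99 / 100 * A ^ 2 := by nlinarith
    have h3 : 1 + A ≤ 19 / 18 * A := by linarith
    gcongr
  -- For fixed ρ the left side is largest at ρ = √2.97 A, about 1.73 A, whence the squares used as
  -- hints.
  have h3 : A * (ρ ^ 2 - 99 / 100 * A ^ 2) ≤ 9 / 20 * ρ ^ 3 := by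
    nlinarith [mul_nonneg hρ (sq_nonneg (ρ - 173 / 100 * A)),
      mul_nonneg (show 0 ≤ A by linarith) (sq_nonneg (ρ - 173 / 100 * A)),
      pow_nonneg hρ 3, pow_nonneg (show 0 ≤ A by linarith) 3]
  have h4 : 0 ≤ (1 + A) * (1 + B ^ 2) := by positivity
  have h5 : 0 ≤ (1 + r) * (1 + r ^ 3) ^ 2 := by positivity
  have h6 := mul_le_mul (h2.trans (show 19 / 18 * A * (ρ ^ 2 - 99 / 100 * A ^ 2) ≤
    19 / 18 * (9 / 20 * ρ ^ 3) by linarith)) h1 h5 (by positivity)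
  have h7 : 0 ≤ ρ ^ 3 := by positivity
  nlinarith

/-- One factor increases and the other decreases in r, so on a short interval [a, b] the product is
bounded by mixing the endpoints; nine intervals cover [2/5, 1]. -/
theorem laplace_bound_of_small_re {r : ℝ} (hr : 2 / 5 ≤ r) (hr' : r ≤ 1) :
    800 * (1 + r ^ 3) ^ 2 * (21 / 20 - r) ≤ 610 := by
  have key (a b : ℝ) (hb1 : b ≤ 1) (har : a ≤ r) (hrb : r ≤ b)
      (hab : 800 * (1 + b ^ 3) ^ 2 * (21 / 20 - a) ≤ 610) :
      800 * (1 + r ^ 3) ^ 2 * (21 / 20 - r) ≤ 610 := by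
    have h0 : 0 ≤ r := by linarith
    have h1 : 0 ≤ 21 / 20 - r := by linarith
    refine le_trans ?_ hab
    gcongr
  rcases le_total r (42 / 100) with h | h1
  · exact key (2 / 5) _ (by norm_num) hr h (by norm_num)
  rcases le_total r (46 / 100) with h | h2
  · exact key _ _ (by norm_num) h1 h (by norm_num)
  rcases le_total r (51 / 100) with h | h3
  · exact key _ _ (by norm_num) h2 h (by norm_num)
  rcases le_total r (57 / 100) with h | h4
  · exact key _ _ (by norm_num) h3 h (by norm_num)
  rcases le_total r (63 / 100) with h | h5
  · exact key _ _ (by norm_num) h4 h (by norm_num)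
  rcases le_total r (70 / 100) with h | h6
  · exact key _ _ (by norm_num) h5 h (by norm_num)
  rcases le_total r (78 / 100) with h | h7
  · exact key _ _ (by norm_num) h6 h (by norm_num)
  rcases le_total r (87 / 100) with h | h8
  · exact key _ _ (by norm_num) h7 h (by norm_num)
  · exact key _ _ le_rfl h8 hr' (by norm_num)

theorem norm_integral_bump_mul_exp_le {z : ℂ} (hz : 0 ≤ z.re) :
    (1 + z.re) * (1 + z.im ^ 2) *
      ‖∫ u in (0 : ℝ)..(7 / 20), (bump u : ℂ) * exp (-(z * u))‖ ≤ 610 := by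
  rcases eq_or_ne z 0 with rfl | hz0
  · have : ‖∫ u in (0 : ℝ)..(7 / 20), (bump u : ℂ) * exp (-(0 * u))‖ ≤ 7 * |7 / 20 - 0| := by
      refine norm_integral_le_of_norm_le_const fun u _ => ?_
      obtain ⟨h0, h7, -⟩ := bump_bounds u
      simpa [abs_of_nonneg h0] using h7
    rw [sub_zero, abs_of_pos (by norm_num)] at this
    simp only [Complex.zero_re, Complex.zero_im]
    linarith
  have hρ : 0 < ‖z‖ := norm_pos_iff.mpr hz0
  have hρ2 : ‖z‖ ^ 2 = z.re ^ 2 + z.im ^ 2 := by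
    rw [Complex.sq_norm, Complex.normSq_apply]; ring
  rw [integral_bump_mul_exp hz0, norm_div, norm_mul, norm_mul, norm_pow, norm_pow]
  have hw1 : exp (-(z * (1 / 20))) = exp (-(z * ((1 / 20 : ℝ) : ℂ))) := by push_cast; rfl
  have hw3 : exp (-(z * (3 / 20))) = exp (-(z * ((3 / 20 : ℝ) : ℂ))) := by push_cast; rfl
  rw [hw1, hw3, Complex.norm_ofNat]
  have a1 := norm_one_sub_exp_neg_mul_le_mul hz (w := 1 / 20) (by norm_num)
  have a3 := norm_one_sub_exp_neg_mul_le_mul hz (w := 3 / 20) (by norm_num)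
  have b1 := norm_one_sub_exp_neg_mul_le_one_add z (1 / 20)
  have b3 := norm_one_sub_exp_neg_mul_le_one_add z (3 / 20)
  have c1 := fun h => norm_one_sub_exp_neg_mul_le_div (z := z) h (w := 1 / 20) (by norm_num)
  have hr3 : Real.exp (-(z.re * (3 / 20))) = Real.exp (-(z.re * (1 / 20))) ^ 3 := by
    rw [← Real.exp_nat_mul]; congr 1; push_cast; ring
  have hr0 := Real.exp_pos (-(z.re * (1 / 20)))
  have hr1 : Real.exp (-(z.re * (1 / 20))) ≤ 1 := Real.exp_le_one_iff.mpr (by linarith)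
  have hrA : 1 - Real.exp (-(z.re * (1 / 20))) ≤ z.re / 20 := by
    linarith [Real.add_one_le_exp (-(z.re * (1 / 20)))]
  -- Indeed e^{-9/10} ≥ 2/5, because e⁹ ≤ 2.72⁹ ≤ (5/2)¹⁰.
  have hlarge : Real.exp (-(z.re * (1 / 20))) < 2 / 5 → 18 ≤ z.re := by
    intro h
    by_contra! hlt
    have h1 : Real.exp (-(9 / 10)) ≤ Real.exp (-(z.re * (1 / 20))) :=
      Real.exp_le_exp.mpr (by linarith)
    have h2 : (2 / 5 : ℝ) ≤ Real.exp (-(9 / 10)) := by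
      have h3 : Real.exp (9 / 10) ^ 10 ≤ (5 / 2) ^ 10 := by
        calc Real.exp (9 / 10) ^ 10 = Real.exp 1 ^ 9 := by
              rw [← Real.exp_nat_mul, ← Real.exp_nat_mul]; norm_num
          _ ≤ (272 / 100) ^ 9 := by
              gcongr
              linarith [Real.exp_one_lt_d9]
          _ ≤ (5 / 2) ^ 10 := by norm_num
      have h4 := le_of_pow_le_pow_left₀ (by norm_num) (by norm_num) h3
      rw [Real.exp_neg, show (2 / 5 : ℝ) = (5 / 2)⁻¹ by norm_num]
      exact inv_anti₀ (Real.exp_pos _) h4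
    linarith
  rw [hr3] at b3
  have hx : 0 ≤ ‖1 - exp (-(z * ((1 / 20 : ℝ) : ℂ)))‖ := norm_nonneg _
  generalize ‖1 - exp (-(z * ((1 / 20 : ℝ) : ℂ)))‖ = x at *
  have hy : 0 ≤ ‖1 - exp (-(z * ((3 / 20 : ℝ) : ℂ)))‖ := norm_nonneg _
  generalize ‖1 - exp (-(z * ((3 / 20 : ℝ) : ℂ)))‖ = y at *
  generalize Real.exp (-(z.re * (1 / 20))) = r at *
  generalize ‖z‖ = ρ at *
  generalize z.re = A at *
  generalize z.im = B at *
  rw [← mul_div_assoc, div_le_iff₀ (by positivity)]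
  -- Four ranges: small |z|; Re z < 1; Re z ≥ 18, where r < 2/5; and the remaining one. Only the
  -- last two come close to 610.
  rcases lt_or_ge (ρ ^ 2) 2 with h2 | h2
  · have hA : 1 + A ≤ 3 := by nlinarith
    have hB : 1 + B ^ 2 ≤ 3 := by nlinarith
    calc (1 + A) * (1 + B ^ 2) * (800 * x * y ^ 2)
        ≤ 3 * 3 * (800 * (ρ * (1 / 20)) * (ρ * (3 / 20)) ^ 2) := by gcongr
      _ ≤ 610 * ρ ^ 3 := by nlinarith [pow_pos hρ 3]
  rcases lt_or_ge A 1 with hA | hA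
  · have hB : 1 + B ^ 2 ≤ 3 / 2 * ρ ^ 2 := by nlinarith
    have hy2 : y ≤ 2 := b3.trans (by nlinarith [pow_le_one₀ (n := 3) hr0.le hr1])
    calc (1 + A) * (1 + B ^ 2) * (800 * x * y ^ 2)
        ≤ 2 * (3 / 2 * ρ ^ 2) * (800 * (ρ * (1 / 20)) * 2 ^ 2) := by
          gcongr
          linarith
      _ ≤ 610 * ρ ^ 3 := by nlinarith [pow_pos hρ 3]
  rcases lt_or_ge r (2 / 5) with hr | hr
  · calc (1 + A) * (1 + B ^ 2) * (800 * x * y ^ 2)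
        ≤ (1 + A) * (1 + B ^ 2) * (800 * (1 + r) * (1 + r ^ 3) ^ 2) := by gcongr
      _ ≤ 610 * ρ ^ 3 := laplace_bound_of_large_re (hlarge hr) hρ.le hρ2 hr0.le hr.le
  · have hA0 : 0 < A := by linarith
    have hB : 1 + B ^ 2 ≤ ρ ^ 2 := by nlinarith
    calc (1 + A) * (1 + B ^ 2) * (800 * x * y ^ 2)
        ≤ (1 + A) * ρ ^ 2 * (800 * (ρ * ((1 - r) / A)) * (1 + r ^ 3) ^ 2) := by
          gcongr
          exact c1 hA0
      _ = 800 * (1 + r ^ 3) ^ 2 * ((1 - r) / A + (1 - r)) * ρ ^ 3 := by field_simp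
      _ ≤ 800 * (1 + r ^ 3) ^ 2 * (21 / 20 - r) * ρ ^ 3 := by
          -- This is 1 - e^{-A/20} ≤ A/20.
          have : (1 - r) / A ≤ 1 / 20 := by rw [div_le_iff₀ hA0]; linarith
          gcongr
          linarith
      _ ≤ 610 * ρ ^ 3 := by
          gcongr
          exact laplace_bound_of_small_re hr hr1

end LaplaceTransform

/-! ### Partial summation against the Selberg majorant -/

section KernelEstimate

open MeasureTheory

/-- Abel summation on the sum and integration by parts on the integral: the boundary terms vanish
with f, and the difference is at most E ∫ |f'| ≤ E D ∫_a^b x⁻² dx. -/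
theorem norm_sum_mul_sub_integral_le {ν : ℕ → ℝ} {Q E D a b : ℝ} (hE : 0 ≤ E)
    (hν : ∀ x : ℝ, 0 ≤ x → |∑ k ∈ Finset.Icc 0 ⌊x⌋₊, ν k - Q * x| ≤ E) (ha : 0 < a) (hab : a ≤ b)
    {f f' : ℝ → ℂ} (hf : ∀ x ∈ Set.Icc a b, HasDerivAt f (f' x) x)
    (hf' : ContinuousOn f' (Set.Icc a b)) (hfa : f a = 0) (hfb : f b = 0)
    (hD : ∀ x ∈ Set.Icc a b, ‖f' x‖ ≤ D * (x ^ 2)⁻¹) :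
    ‖∑ k ∈ Finset.Ioc ⌊a⌋₊ ⌊b⌋₊, f k * ν k - Q * ∫ x in a..b, f x‖ ≤ E * D / a := by
  have hD0 : 0 ≤ D := by
    have h := (norm_nonneg _).trans (hD a ⟨le_rfl, hab⟩)
    exact nonneg_of_mul_nonneg_left h (by positivity)
  have hderiv : Set.EqOn (deriv f) f' (Set.Icc a b) := fun x hx => (hf x hx).deriv
  have hint' : IntegrableOn f' (Set.Icc a b) := hf'.integrableOn_Icc
  have hint : IntegrableOn (deriv f) (Set.Icc a b) :=
    hint'.congr_fun hderiv.symm measurableSet_Icc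
  have h1 := sum_mul_eq_sub_sub_integral_mul (fun k => (ν k : ℂ)) ha.le hab
    (fun t ht => (hf t ht).differentiableAt) hint
  rw [hfa, hfb, zero_mul, zero_mul, sub_zero, zero_sub] at h1
  have hI1 : IntegrableOn (fun t => deriv f t * ∑ k ∈ Finset.Icc 0 ⌊t⌋₊, (ν k : ℂ))
      (Set.Icc a b) := integrableOn_mul_sum_Icc (m := 0) (fun k => (ν k : ℂ)) ha.le hint
  have h2 : ∫ x in a..b, f x = -∫ x in a..b, (x : ℂ) * f' x := by
    have hid : ∀ x ∈ Set.uIcc a b, HasDerivAt (fun x : ℝ => (x : ℂ)) 1 x := fun x _ =>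
      Complex.ofRealCLM.hasDerivAt
    rw [← Set.uIcc_of_le hab] at hf hf'
    have := intervalIntegral.integral_mul_deriv_eq_deriv_mul hid hf
      (by simp) hf'.intervalIntegrable
    rw [this, hfa, hfb]
    simp
  rw [h1, h2, ← intervalIntegral.integral_of_le hab]
  have hI1' : IntervalIntegrable (fun t => deriv f t * ∑ k ∈ Finset.Icc 0 ⌊t⌋₊, (ν k : ℂ))
      volume a b := (intervalIntegrable_iff_integrableOn_Icc_of_le hab).mpr hI1
  have hI2 : IntervalIntegrable (fun x : ℝ => (Q : ℂ) * ((x : ℂ) * f' x)) volume a b := by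
    refine ContinuousOn.intervalIntegrable ?_
    rw [Set.uIcc_of_le hab]
    exact continuousOn_const.mul (Complex.continuous_ofReal.continuousOn.mul hf')
  rw [mul_neg, sub_neg_eq_add, ← intervalIntegral.integral_const_mul, neg_add_eq_sub,
    ← intervalIntegral.integral_sub hI2 hI1']
  have h0 : (0 : ℝ) ∉ Set.uIcc a b := by
    rw [Set.uIcc_of_le hab]
    exact fun h => absurd h.1 (not_le.mpr ha)
  have hbound : IntervalIntegrable (fun x : ℝ => E * D * (x ^ 2)⁻¹) volume a b := by
    refine ContinuousOn.intervalIntegrable ?_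
    refine continuousOn_const.mul (ContinuousOn.inv₀ (by fun_prop) fun x hx hx0 => ?_)
    exact h0 (pow_eq_zero_iff two_ne_zero |>.mp hx0 ▸ hx)
  refine (intervalIntegral.norm_integral_le_of_norm_le hab ?_ hbound).trans ?_
  · refine Filter.Eventually.of_forall fun x hx => ?_
    have hx' : x ∈ Set.Icc a b := ⟨hx.1.le, hx.2⟩
    have hx0 : 0 ≤ x := ha.le.trans hx'.1
    have heq : (Q : ℂ) * ((x : ℂ) * f' x) - deriv f x * ∑ k ∈ Finset.Icc 0 ⌊x⌋₊, (ν k : ℂ) =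
        -(f' x * ((∑ k ∈ Finset.Icc 0 ⌊x⌋₊, ν k - Q * x : ℝ) : ℂ)) := by
      rw [hderiv hx']
      push_cast
      ring
    rw [heq, norm_neg, norm_mul, Complex.norm_real, Real.norm_eq_abs]
    calc ‖f' x‖ * |∑ k ∈ Finset.Icc 0 ⌊x⌋₊, ν k - Q * x| ≤ D * (x ^ 2)⁻¹ * E := by
          exact mul_le_mul (hD x hx') (hν x hx0) (abs_nonneg _) (by positivity)
      _ = E * D * (x ^ 2)⁻¹ := by ring
  · have hb : 0 < b := ha.trans_le hab
    have hF : ∀ x ∈ Set.uIcc a b, HasDerivAt (fun x : ℝ => -(x⁻¹)) ((x ^ 2)⁻¹) x := by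
      intro x hx
      have hx0 : x ≠ 0 := fun h => h0 (h ▸ hx)
      simpa using (hasDerivAt_inv hx0).fun_neg
    have hci : IntervalIntegrable (fun x : ℝ => (x ^ 2)⁻¹) volume a b := by
      refine ContinuousOn.intervalIntegrable (ContinuousOn.inv₀ (by fun_prop) fun x hx hx0 => ?_)
      exact h0 (pow_eq_zero_iff two_ne_zero |>.mp hx0 ▸ hx)
    rw [intervalIntegral.integral_const_mul, intervalIntegral.integral_eq_sub_of_hasDerivAt hF hci,
      div_eq_mul_inv]
    have : 0 < b⁻¹ := by positivity
    gcongr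
    linarith

/-- The function `x ↦ x⁻¹ bump(u) e^{-zu}` with `u = 5/4 - (log x) / L`. -/
noncomputable def bumpKernel (L : ℝ) (z : ℂ) (x : ℝ) : ℂ :=
  (x : ℂ)⁻¹ * (bump (5 / 4 - Real.log x / L) *
    Complex.exp (-(z * ((5 / 4 - Real.log x / L : ℝ) : ℂ))))

theorem integral_bumpKernel {L : ℝ} (hL : 0 < L) (z : ℂ) :
    ∫ x in Real.exp (9 / 10 * L)..Real.exp (5 / 4 * L), bumpKernel L z x =
      L * ∫ u in (0 : ℝ)..(7 / 20), (bump u : ℂ) * Complex.exp (-(z * u)) := by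
  have hpos : ∀ x ∈ Set.uIcc (Real.exp (9 / 10 * L)) (Real.exp (5 / 4 * L)), 0 < x := by
    intro x hx
    rw [Set.uIcc_of_le (Real.exp_le_exp.mpr (by nlinarith))] at hx
    exact (Real.exp_pos _).trans_le hx.1
  have hderiv : ∀ x ∈ Set.uIcc (Real.exp (9 / 10 * L)) (Real.exp (5 / 4 * L)),
      HasDerivAt (fun x => 5 / 4 - Real.log x / L) (-(x⁻¹ / L)) x := fun x hx =>
    ((Real.hasDerivAt_log (hpos x hx).ne').div_const L).const_sub (5 / 4)
  have hcont : ContinuousOn (fun x : ℝ => -(x⁻¹ / L))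
      (Set.uIcc (Real.exp (9 / 10 * L)) (Real.exp (5 / 4 * L))) :=
    ((continuousOn_inv₀.mono fun x hx => (hpos x hx).ne').div_const L).neg
  have hG : Continuous fun u : ℝ => (bump u : ℂ) * Complex.exp (-(z * u)) := by
    have := continuous_bump
    fun_prop
  have h := intervalIntegral.integral_deriv_smul_comp hderiv hcont hG
  rw [Real.log_exp, Real.log_exp, mul_div_cancel_right₀ _ hL.ne', mul_div_cancel_right₀ _ hL.ne',
    show (5 / 4 - 9 / 10 : ℝ) = 7 / 20 by norm_num, sub_self] at h
  have h' : ∫ u in (0 : ℝ)..(7 / 20), (bump u : ℂ) * Complex.exp (-(z * u)) =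
      ∫ x in Real.exp (9 / 10 * L)..Real.exp (5 / 4 * L), (L : ℂ)⁻¹ * bumpKernel L z x := by
    rw [intervalIntegral.integral_symm, ← h, ← intervalIntegral.integral_neg]
    refine intervalIntegral.integral_congr fun x _ => ?_
    simp only [bumpKernel, Function.comp, Complex.real_smul]
    push_cast
    ring
  have hLC : (L : ℂ) ≠ 0 := by exact_mod_cast hL.ne'
  rw [h', intervalIntegral.integral_const_mul, mul_inv_cancel_left₀ hLC]

/-- The derivative of `bumpKernel`. -/
noncomputable def bumpKernelDeriv (L : ℝ) (z : ℂ) (x : ℝ) : ℂ :=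
  -((x : ℂ) ^ 2)⁻¹ * ((bump (5 / 4 - Real.log x / L) +
    (bumpDeriv (5 / 4 - Real.log x / L) - z * bump (5 / 4 - Real.log x / L)) / L) *
    Complex.exp (-(z * ((5 / 4 - Real.log x / L : ℝ) : ℂ))))

theorem hasDerivAt_bumpKernel {L : ℝ} (hL : L ≠ 0) (z : ℂ) {x : ℝ} (hx : x ≠ 0) :
    HasDerivAt (bumpKernel L z) (bumpKernelDeriv L z x) x := by
  have hu : HasDerivAt (fun x => 5 / 4 - Real.log x / L) (-(x⁻¹ / L)) x :=
    ((Real.hasDerivAt_log hx).div_const L).const_sub (5 / 4)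
  have hb := ((hasDerivAt_bump (5 / 4 - Real.log x / L)).comp x hu).ofReal_comp
  have he := ((hu.ofReal_comp.const_mul z).neg).cexp
  have hid : HasDerivAt (fun u : ℝ => (u : ℂ)) 1 x := Complex.ofRealCLM.hasDerivAt
  have hxC : (x : ℂ) ≠ 0 := by exact_mod_cast hx
  have hLC : (L : ℂ) ≠ 0 := by exact_mod_cast hL
  have hinv : HasDerivAt (fun u : ℝ => (u : ℂ)⁻¹) (-((x : ℂ) ^ 2)⁻¹) x := by
    simpa [div_eq_mul_inv] using hid.fun_inv hxC
  refine (hinv.mul (hb.mul he)).congr_deriv ?_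
  simp only [bumpKernelDeriv, Function.comp, Pi.mul_apply, Pi.neg_apply]
  push_cast
  field_simp
  ring

theorem continuousOn_bumpKernelDeriv (L : ℝ) (z : ℂ) {s : Set ℝ} (hs : ∀ x ∈ s, x ≠ 0) :
    ContinuousOn (bumpKernelDeriv L z) s := by
  have hu : ContinuousOn (fun x => 5 / 4 - Real.log x / L) s :=
    continuousOn_const.sub ((Real.continuousOn_log.mono hs).div_const L)
  have hb : ContinuousOn (fun x => (bump (5 / 4 - Real.log x / L) : ℂ)) s :=
    Complex.continuous_ofReal.comp_continuousOn (continuous_bump.comp_continuousOn hu)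
  have hb' : ContinuousOn (fun x => (bumpDeriv (5 / 4 - Real.log x / L) : ℂ)) s :=
    Complex.continuous_ofReal.comp_continuousOn (continuous_bumpDeriv.comp_continuousOn hu)
  have he : ContinuousOn (fun x => Complex.exp (-(z * ((5 / 4 - Real.log x / L : ℝ) : ℂ)))) s :=
    (continuousOn_const.mul (Complex.continuous_ofReal.comp_continuousOn hu)).neg.cexp
  have hx : ContinuousOn (fun x : ℝ => -((x : ℂ) ^ 2)⁻¹) s := by
    refine (ContinuousOn.inv₀ (by fun_prop) fun x hxs => ?_).neg
    exact pow_ne_zero 2 (by exact_mod_cast hs x hxs)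
  exact hx.mul ((hb.add ((hb'.sub (continuousOn_const.mul hb)).div_const _)).mul he)

/-- On this range u ≥ 0, so |e^{-zu}| ≤ 1, and differentiating the exponential costs only |z|/L ≤
4T. -/
theorem exists_norm_bumpKernelDeriv_le :
    ∃ D : ℝ, 0 < D ∧ ∀ (L T : ℝ), 1 ≤ L → 1 ≤ T → ∀ z : ℂ, 0 ≤ z.re → z.re ≤ 2 * L →
      |z.im| ≤ 2 * T * L → ∀ x ∈ Set.Icc (Real.exp (9 / 10 * L)) (Real.exp (5 / 4 * L)),
        ‖bumpKernelDeriv L z x‖ ≤ D * T * (x ^ 2)⁻¹ := by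
  obtain ⟨M, hM⟩ := (isCompact_Icc (a := (0 : ℝ)) (b := 7 / 20)).exists_bound_of_continuousOn
    continuous_bumpDeriv.continuousOn
  have hM0 : 0 ≤ M := (norm_nonneg _).trans (hM 0 (by norm_num))
  refine ⟨M + 35, by linarith, fun L T hL hT z hz0 hz2 hzi x hx => ?_⟩
  have hL0 : 0 < L := by linarith
  have hx0 : 0 < x := (Real.exp_pos _).trans_le hx.1
  have hl1 : 9 / 10 * L ≤ Real.log x := (Real.le_log_iff_exp_le hx0).mpr hx.1
  have hl2 : Real.log x ≤ 5 / 4 * L := (Real.log_le_iff_le_exp hx0).mpr hx.2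
  have hu0 : 0 ≤ 5 / 4 - Real.log x / L := by
    rw [sub_nonneg, div_le_iff₀ hL0]; exact hl2
  have hu1 : 5 / 4 - Real.log x / L ≤ 7 / 20 := by
    have : 9 / 10 ≤ Real.log x / L := by rw [le_div_iff₀ hL0]; exact hl1
    linarith
  rw [bumpKernelDeriv]
  generalize 5 / 4 - Real.log x / L = u at *
  obtain ⟨hb0, hb7, -⟩ := bump_bounds u
  have hexp : ‖Complex.exp (-(z * (u : ℂ)))‖ ≤ 1 := by
    rw [Complex.norm_exp, Real.exp_le_one_iff]
    simpa using mul_nonneg hz0 hu0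
  have hz : ‖z‖ ≤ 4 * T * L := by
    have := Complex.norm_le_abs_re_add_abs_im z
    rw [abs_of_nonneg hz0] at this
    nlinarith
  have hbn : ‖(bump u : ℂ)‖ ≤ 7 := by
    rw [Complex.norm_real, Real.norm_eq_abs, abs_of_nonneg hb0]; exact hb7
  have hbn' : ‖(bumpDeriv u : ℂ)‖ ≤ M := by
    rw [Complex.norm_real]; exact hM u ⟨hu0, hu1⟩
  have hmid : ‖((bumpDeriv u : ℂ) - z * bump u) / L‖ ≤ (M + 28) * T := by
    rw [norm_div, Complex.norm_real, Real.norm_eq_abs, abs_of_pos hL0, div_le_iff₀ hL0]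
    calc ‖(bumpDeriv u : ℂ) - z * bump u‖ ≤ ‖(bumpDeriv u : ℂ)‖ + ‖z‖ * ‖(bump u : ℂ)‖ :=
          (norm_sub_le _ _).trans_eq (by rw [norm_mul])
      _ ≤ M + 4 * T * L * 7 := by gcongr
      _ ≤ (M + 28) * T * L := by
          have : 1 ≤ T * L := one_le_mul_of_one_le_of_one_le hT hL
          nlinarith
  have hx2 : ‖-((x : ℂ) ^ 2)⁻¹‖ = (x ^ 2)⁻¹ := by
    rw [norm_neg, norm_inv, norm_pow, Complex.norm_real, Real.norm_eq_abs, sq_abs]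
  rw [norm_mul, norm_mul, hx2, mul_comm]
  refine mul_le_mul_of_nonneg_right ?_ (by positivity)
  calc ‖(bump u : ℂ) + ((bumpDeriv u : ℂ) - z * bump u) / L‖ *
        ‖Complex.exp (-(z * (u : ℂ)))‖ ≤ (7 + (M + 28) * T) * 1 := by
        gcongr
        exact (norm_add_le _ _).trans (add_le_add hbn hmid)
    _ ≤ (M + 35) * T := by nlinarith

theorem exists_norm_sum_bumpKernel_mul_selbergMajorant_le :
    ∃ C : ℝ, 0 < C ∧ ∀ (L T : ℝ), 1 ≤ L → 1 ≤ T → ∀ z : ℂ, 0 ≤ z.re → z.re ≤ 2 * L →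
      |z.im| ≤ 2 * T * L →
      ‖∑ n ∈ Finset.Ioc ⌊Real.exp (9 / 10 * L)⌋₊ ⌊Real.exp (5 / 4 * L)⌋₊,
          bumpKernel L z n * selbergMajorant ⌊Real.exp (11 / 25 * L)⌋₊ n‖ ≤
        1387 * ((1 + z.re)⁻¹ * (1 + z.im ^ 2)⁻¹) + C * (T * L ^ (-4 : ℤ)) := by
  obtain ⟨D, hD, hDb⟩ := exists_norm_bumpKernelDeriv_le
  -- The constant comes from e^{L/50} ≥ (L/50)⁴/24, where 1/50 = 9/10 - 2 · 11/25.
  refine ⟨D * (24 * 50 ^ 4), by positivity, fun L T hL hT z hz0 hz2 hzi => ?_⟩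
  have hL0 : 0 < L := by linarith
  set R := ⌊Real.exp (11 / 25 * L)⌋₊ with hRdef
  have hR : 1 ≤ R := Nat.one_le_floor_iff _ |>.mpr (Real.one_le_exp (by positivity))
  have hab : Real.exp (9 / 10 * L) ≤ Real.exp (5 / 4 * L) := Real.exp_le_exp.mpr (by linarith)
  have hpos : ∀ x ∈ Set.Icc (Real.exp (9 / 10 * L)) (Real.exp (5 / 4 * L)), x ≠ 0 := fun x hx =>
    ((Real.exp_pos _).trans_le hx.1).ne'
  have hfa : bumpKernel L z (Real.exp (9 / 10 * L)) = 0 := by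
    rw [bumpKernel, Real.log_exp, mul_div_cancel_right₀ _ hL0.ne', bump_eq_of_ge (by norm_num)]
    simp
  have hfb : bumpKernel L z (Real.exp (5 / 4 * L)) = 0 := by
    rw [bumpKernel, Real.log_exp, mul_div_cancel_right₀ _ hL0.ne', bump_eq_of_nonpos (by norm_num)]
    simp
  have key := norm_sum_mul_sub_integral_le (sq_nonneg (R : ℝ))
    (fun x hx => abs_sum_selbergMajorant_sub_le hR hx) (Real.exp_pos _) hab
    (fun x hx => hasDerivAt_bumpKernel hL0.ne' z (hpos x hx))
    (continuousOn_bumpKernelDeriv L z hpos) hfa hfb (hDb L T hL hT z hz0 hz2 hzi)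
  have hmass : 11 / 25 * L ≤ selbergMass R := by
    refine le_trans ?_ (log_le_selbergMass R)
    rw [Real.le_log_iff_exp_le (by positivity)]
    exact (Nat.lt_floor_add_one _).le
  have hmain : ‖((selbergMass R)⁻¹ : ℂ) * ∫ x in Real.exp (9 / 10 * L)..Real.exp (5 / 4 * L),
      bumpKernel L z x‖ ≤ 1387 * ((1 + z.re)⁻¹ * (1 + z.im ^ 2)⁻¹) := by
    have hm0 : 0 < selbergMass R := selbergMass_pos hR
    have hlap := norm_integral_bump_mul_exp_le hz0
    rw [integral_bumpKernel hL0, norm_mul, norm_mul, norm_inv, Complex.norm_real, Complex.norm_real,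
      Real.norm_of_nonneg hm0.le, Real.norm_of_nonneg hL0.le, ← mul_inv, ← div_eq_mul_inv,
      le_div_iff₀ (by positivity)]
    have hI := norm_nonneg (∫ u in (0 : ℝ)..(7 / 20), (bump u : ℂ) * Complex.exp (-(z * u)))
    generalize ‖∫ u in (0 : ℝ)..(7 / 20), (bump u : ℂ) * Complex.exp (-(z * u))‖ = I at *
    -- The sieve level enters the main constant here: 25/11 · 610 is just below 1387.
    have hratio : (selbergMass R)⁻¹ * L ≤ 25 / 11 := by
      rw [inv_mul_le_iff₀ hm0]; linarith
    calc (selbergMass R)⁻¹ * (L * I) * ((1 + z.re) * (1 + z.im ^ 2))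
        = (selbergMass R)⁻¹ * L * ((1 + z.re) * (1 + z.im ^ 2) * I) := by ring
      _ ≤ 25 / 11 * 610 :=
          mul_le_mul hratio hlap (by positivity) (by norm_num)
      _ ≤ 1387 := by norm_num
  have herr : (R : ℝ) ^ 2 * (D * T) / Real.exp (9 / 10 * L) ≤
      D * (24 * 50 ^ 4) * (T * L ^ (-4 : ℤ)) := by
    have hR2 : (R : ℝ) ^ 2 ≤ Real.exp (22 / 25 * L) := by
      have h1 : (R : ℝ) ≤ Real.exp (11 / 25 * L) := Nat.floor_le (Real.exp_pos _).le
      calc (R : ℝ) ^ 2 ≤ Real.exp (11 / 25 * L) ^ 2 := by gcongr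
        _ = Real.exp (22 / 25 * L) := by rw [← Real.exp_nat_mul]; congr 1; push_cast; ring
    have hexp : (L / 50) ^ 4 / 24 ≤ Real.exp (L / 50) := by
      have := Real.pow_div_factorial_le_exp (L / 50) (by positivity) 4
      norm_num [Nat.factorial] at this ⊢
      exact this
    have hsplit : Real.exp (9 / 10 * L) = Real.exp (22 / 25 * L) * Real.exp (L / 50) := by
      rw [← Real.exp_add]; congr 1; ring
    rw [hsplit, div_le_iff₀ (by positivity)]
    have hL4 : L ^ (-4 : ℤ) * L ^ 4 = 1 := by
      rw [zpow_neg, show L ^ (4 : ℤ) = L ^ 4 by norm_cast]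
      exact inv_mul_cancel₀ (by positivity)
    calc (R : ℝ) ^ 2 * (D * T) ≤ Real.exp (22 / 25 * L) * (D * T) := by gcongr
      _ = D * (24 * 50 ^ 4) * (T * L ^ (-4 : ℤ)) *
            (Real.exp (22 / 25 * L) * ((L / 50) ^ 4 / 24)) := by
          linear_combination (-(D * T * Real.exp (22 / 25 * L))) * hL4
      _ ≤ _ := by gcongr
  rw [Complex.ofReal_inv] at key
  have := norm_le_insert' (∑ n ∈ Finset.Ioc ⌊Real.exp (9 / 10 * L)⌋₊ ⌊Real.exp (5 / 4 * L)⌋₊,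
    bumpKernel L z n * selbergMajorant R n) (((selbergMass R)⁻¹ : ℂ) *
      ∫ x in Real.exp (9 / 10 * L)..Real.exp (5 / 4 * L), bumpKernel L z x)
  linarith

end KernelEstimate

/-! ### Duality and Schur's test -/

-- Apply the dual inequality to c_j = conj b_j, where b_j is the jth inner sum. Cauchy–Schwarz then
-- gives S² ≤ X Δ S for S = ∑ |b_j|², and S cancels unless it is 0.
open scoped ComplexConjugate in
theorem sum_norm_sq_le_of_dual {ι κ : Type*} [Fintype ι] (s : Finset κ) (x : ι → κ → ℂ)
    (m : κ → ℝ) (hm : ∀ p ∈ s, 0 < m p) {Δ : ℝ} (hΔ : 0 ≤ Δ)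
    (h : ∀ c : ι → ℂ, ∑ p ∈ s, m p * ‖∑ j, c j * x j p‖ ^ 2 ≤ Δ * ∑ j, ‖c j‖ ^ 2) (a : κ → ℂ) :
    ∑ j, ‖∑ p ∈ s, a p * x j p‖ ^ 2 ≤ Δ * ∑ p ∈ s, ‖a p‖ ^ 2 * (m p)⁻¹ := by
  set b : ι → ℂ := fun j => ∑ p ∈ s, a p * x j p with hb
  set y : κ → ℂ := fun p => ∑ j, conj (b j) * x j p with hy
  set S := ∑ j, ‖b j‖ ^ 2 with hS
  set X := ∑ p ∈ s, ‖a p‖ ^ 2 * (m p)⁻¹ with hX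
  have hX0 : 0 ≤ X := Finset.sum_nonneg fun p hp => by have := hm p hp; positivity
  have hS0 : 0 ≤ S := Finset.sum_nonneg fun _ _ => by positivity
  have hSeq : (S : ℂ) = ∑ p ∈ s, a p * y p := by
    simp only [hS, hy, Finset.mul_sum, Complex.ofReal_sum]
    rw [Finset.sum_comm]
    refine Finset.sum_congr rfl fun j _ => ?_
    rw [Complex.ofReal_pow, ← Complex.conj_mul', hb, Finset.mul_sum]
    exact Finset.sum_congr rfl fun p _ => by ring
  have hSle : S ≤ ∑ p ∈ s, (‖a p‖ * (Real.sqrt (m p))⁻¹) * (Real.sqrt (m p) * ‖y p‖) := by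
    calc S = ‖(S : ℂ)‖ := by rw [Complex.norm_real, Real.norm_of_nonneg hS0]
      _ ≤ ∑ p ∈ s, ‖a p * y p‖ := hSeq ▸ norm_sum_le _ _
      _ = _ := Finset.sum_congr rfl fun p hp => by
          have := Real.sqrt_pos.mpr (hm p hp)
          rw [norm_mul]
          field_simp
  have hCS : S ^ 2 ≤ X * (Δ * S) := by
    calc S ^ 2 ≤ (∑ p ∈ s, (‖a p‖ * (Real.sqrt (m p))⁻¹) * (Real.sqrt (m p) * ‖y p‖)) ^ 2 := by
          gcongr
      _ ≤ (∑ p ∈ s, (‖a p‖ * (Real.sqrt (m p))⁻¹) ^ 2) *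
            ∑ p ∈ s, (Real.sqrt (m p) * ‖y p‖) ^ 2 := Finset.sum_mul_sq_le_sq_mul_sq _ _ _
      _ = X * ∑ p ∈ s, m p * ‖y p‖ ^ 2 := by
          congr 1 <;> refine Finset.sum_congr rfl fun p hp => ?_
          · rw [mul_pow, inv_pow, Real.sq_sqrt (hm p hp).le]
          · rw [mul_pow, Real.sq_sqrt (hm p hp).le]
      _ ≤ X * (Δ * S) := by
          gcongr
          simpa using h fun j => conj (b j)
  rcases hS0.eq_or_lt with h0 | h0
  · rw [← h0]; positivity
  · nlinarith

/-- Schur's test: 2 c_j c_k ≤ c_j² + c_k², and by symmetry both halves have the same sum. -/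
theorem sum_sum_mul_le_of_row_sum_le {ι : Type*} [Fintype ι] {B : ι → ι → ℝ} {Δ : ℝ}
    (hsymm : ∀ j k, B j k = B k j) (hB : ∀ j k, 0 ≤ B j k) (hrow : ∀ j, ∑ k, B j k ≤ Δ)
    (c : ι → ℝ) : ∑ j, ∑ k, c j * c k * B j k ≤ Δ * ∑ j, c j ^ 2 := by
  have h1 : ∑ j, ∑ k, c k ^ 2 * B j k = ∑ j, ∑ k, c j ^ 2 * B j k := by
    rw [Finset.sum_comm]
    simp_rw [hsymm]
  calc ∑ j, ∑ k, c j * c k * B j k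
      ≤ ∑ j, ∑ k, (c j ^ 2 * B j k + c k ^ 2 * B j k) / 2 := by
        gcongr with j _ k _
        nlinarith [mul_nonneg (sq_nonneg (c j - c k)) (hB j k)]
    _ = ∑ j, ∑ k, c j ^ 2 * B j k := by
        simp_rw [← Finset.sum_div, Finset.sum_add_distrib, h1]
        ring
    _ ≤ ∑ j, c j ^ 2 * Δ := by
        simp_rw [← Finset.mul_sum]
        gcongr with j _
        exact hrow j
    _ = Δ * ∑ j, c j ^ 2 := by rw [← Finset.sum_mul, mul_comm]

open scoped ComplexConjugate in
theorem sum_mul_norm_sq_le_of_norm_gram_le {ι κ : Type*} [Fintype ι] (S : Finset κ)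
    (m : κ → ℝ) (x : ι → κ → ℂ) {B : ι → ι → ℝ} {Δ : ℝ}
    (hsymm : ∀ j k, B j k = B k j) (hrow : ∀ j, ∑ k, B j k ≤ Δ)
    (hB : ∀ j k, ‖∑ n ∈ S, (m n : ℂ) * (x j n * conj (x k n))‖ ≤ B j k) (c : ι → ℂ) :
    ∑ n ∈ S, m n * ‖∑ j, c j * x j n‖ ^ 2 ≤ Δ * ∑ j, ‖c j‖ ^ 2 := by
  have hexp : ((∑ n ∈ S, m n * ‖∑ j, c j * x j n‖ ^ 2 : ℝ) : ℂ) =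
      ∑ j, ∑ k, c j * conj (c k) * ∑ n ∈ S, (m n : ℂ) * (x j n * conj (x k n)) := by
    simp_rw [Finset.mul_sum]
    rw [Finset.sum_congr rfl fun j _ => Finset.sum_comm, Finset.sum_comm, Complex.ofReal_sum]
    refine Finset.sum_congr rfl fun n _ => ?_
    rw [Complex.ofReal_mul, Complex.ofReal_pow, ← Complex.mul_conj', map_sum, Finset.sum_mul_sum,
      Finset.mul_sum]
    refine Finset.sum_congr rfl fun j _ => ?_
    rw [Finset.mul_sum]
    refine Finset.sum_congr rfl fun k _ => ?_
    rw [map_mul]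
    ring
  calc ∑ n ∈ S, m n * ‖∑ j, c j * x j n‖ ^ 2
      ≤ ‖((∑ n ∈ S, m n * ‖∑ j, c j * x j n‖ ^ 2 : ℝ) : ℂ)‖ := by
        rw [Complex.norm_real]; exact Real.le_norm_self _
    _ ≤ ∑ j, ∑ k, ‖c j‖ * ‖c k‖ * B j k := by
        rw [hexp]
        refine (norm_sum_le _ _).trans (Finset.sum_le_sum fun j _ => ?_)
        refine (norm_sum_le _ _).trans (Finset.sum_le_sum fun k _ => ?_)
        rw [norm_mul, norm_mul, RCLike.norm_conj]
        gcongr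
        exact hB j k
    _ ≤ Δ * ∑ j, ‖c j‖ ^ 2 := sum_sum_mul_le_of_row_sum_le hsymm
        (fun j k => (norm_nonneg _).trans (hB j k)) hrow fun j => ‖c j‖

-- The normalisation e^{5/4 L (Re s - 1)} supplies the 5/4 in u = 5/4 - (log n)/L up to modulus; the
-- imaginary part of z leaves a phase.
open scoped ComplexConjugate in
theorem natCast_mul_cpow_mul_conj_eq_bumpKernel {L : ℝ} (hL : L ≠ 0) {n : ℕ} (hn : n ≠ 0)
    (s s' : ℂ) :
    (bump (5 / 4 - Real.log n / L) : ℂ) * (n * (Real.exp (5 / 4 * L * (s.re - 1)) * (n : ℂ) ^ (-s) *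
      conj (Real.exp (5 / 4 * L * (s'.re - 1)) * (n : ℂ) ^ (-s')))) =
    Complex.exp (((5 / 4 * L * (s'.im - s.im) : ℝ) : ℂ) * Complex.I) *
      bumpKernel L (L * (2 - s - conj s')) n := by
  have hnC : (n : ℂ) ≠ 0 := by exact_mod_cast hn
  have hLC : (L : ℂ) ≠ 0 := by exact_mod_cast hL
  have hexp : (n : ℂ) = Complex.exp (Real.log n) := by
    rw [← Complex.ofReal_exp, Real.exp_log (by positivity), Complex.ofReal_natCast]
  have hlog : Complex.log n = (Real.log n : ℂ) := (Complex.natCast_log).symm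
  have h1 : (n : ℂ) ^ (-s) = Complex.exp (Real.log n * -s) := by
    rw [Complex.cpow_def_of_ne_zero hnC, hlog]
  have h2 : conj ((n : ℂ) ^ (-s')) = Complex.exp (Real.log n * -conj s') := by
    rw [Complex.cpow_def_of_ne_zero hnC, hlog, ← Complex.exp_conj, map_mul, map_neg,
      Complex.conj_ofReal]
  rw [bumpKernel, map_mul, Complex.conj_ofReal, h1, h2]
  have h3 : ((n : ℝ) : ℂ)⁻¹ = Complex.exp (-(Real.log n : ℂ)) := by
    rw [Complex.exp_neg, Complex.ofReal_natCast, ← hexp]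
  have h4 : (n : ℂ) * (Real.exp (5 / 4 * L * (s.re - 1)) * Complex.exp (Real.log n * -s) *
      (Real.exp (5 / 4 * L * (s'.re - 1)) * Complex.exp (Real.log n * -conj s'))) =
      Complex.exp (((5 / 4 * L * (s'.im - s.im) : ℝ) : ℂ) * Complex.I) *
        (Complex.exp (-(Real.log n : ℂ)) * Complex.exp (-(L * (2 - s - conj s') *
          ((5 / 4 - Real.log n / L : ℝ) : ℂ)))) := by
    conv_lhs => rw [hexp]
    simp only [Complex.ofReal_exp, ← Complex.exp_add]
    congr 1
    have hs : s = s.re + s.im * Complex.I := (Complex.re_add_im s).symm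
    have hs' : conj s' = s'.re - s'.im * Complex.I := by
      apply Complex.ext <;> simp
    rw [hs']
    generalize s.re = σ at *
    generalize s.im = τ at *
    subst hs
    push_cast
    field_simp
    ring
  rw [h3, h4]
  ring

/-! ### Proof of the inequality -/

theorem lemma3p1 :
    ∃ C : ℝ, 0 < C ∧
      ∀ (P T : ℝ), 3 ≤ P → 1 ≤ T →
      ∀ (N : ℕ) (ρ : Fin N → ℂ),
        (∀ j, 0 ≤ (ρ j).re ∧ (ρ j).re ≤ 1 ∧ |(ρ j).im| ≤ T) →
      ∀ a : ℕ → ℂ,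
        ∑ j, P ^ ((5 / 2 : ℝ) * ((ρ j).re - 1)) *
            ‖∑ p ∈ primeSegment P, a p * (p : ℂ) ^ (-(ρ j))‖ ^ 2
          ≤ (1387 * maxWeightedCount ρ P T + C * ((N : ℝ) * T * (Real.log P) ^ (-4 : ℤ))) *
            ∑ p ∈ primeSegment P, ‖a p‖ ^ 2 * (p : ℝ)⁻¹ := by
  obtain ⟨C, hC, hK⟩ := exists_norm_sum_bumpKernel_mul_selbergMajorant_le
  refine ⟨C, hC, fun P T hP hT N ρ hρ a => ?_⟩
  have hP0 : 0 < P := by linarith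
  set L := Real.log P with hLdef
  have hL : 1 ≤ L := by
    rw [hLdef, Real.le_log_iff_exp_le hP0]
    linarith [Real.exp_one_lt_d9]
  have hL0 : 0 < L := by linarith
  have hPexp (t : ℝ) : P ^ t = Real.exp (t * L) := by rw [Real.rpow_def_of_pos hP0, mul_comm]
  have hPL : Real.exp L = P := Real.exp_log hP0
  have hwc (t : ℝ) : 0 ≤ weightedCount ρ P t := by
    refine Finset.sum_nonneg fun j _ => ?_
    have : 0 ≤ 1 - (ρ j).re := by linarith [(hρ j).2.1]
    rw [← hLdef]
    positivity
  have hmax := isGreatest_maxWeightedCount ρ P T (by linarith)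
  have hV (t : ℝ) (ht : |t| ≤ T) : weightedCount ρ P t ≤ maxWeightedCount ρ P T :=
    hmax.2 ⟨t, abs_le.mp ht, rfl⟩
  have hV0 : 0 ≤ maxWeightedCount ρ P T := (hwc 0).trans (hV 0 (by simpa using by linarith))
  set Δ := 1387 * maxWeightedCount ρ P T + C * ((N : ℝ) * T * L ^ (-4 : ℤ)) with hΔ
  have hΔ0 : 0 ≤ Δ := by positivity
  set x : Fin N → ℕ → ℂ := fun j n =>
    (Real.exp (5 / 4 * L * ((ρ j).re - 1)) : ℂ) * (n : ℂ) ^ (-(ρ j)) with hx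
  have hmem : ∀ p ∈ primeSegment P, p.Prime ∧ P ≤ p ∧ (p : ℝ) ≤ Real.exp (6 / 5 * L) := by
    intro p hp
    have := (mem_primeSegment hP0.le).mp hp
    rwa [hPexp] at this
  have hdual : ∀ c : Fin N → ℂ, ∑ p ∈ primeSegment P, (p : ℝ) * ‖∑ j, c j * x j p‖ ^ 2 ≤
      Δ * ∑ j, ‖c j‖ ^ 2 := by
    intro c
    set R := ⌊Real.exp (11 / 25 * L)⌋₊ with hR
    set S := Finset.Ioc ⌊Real.exp (9 / 10 * L)⌋₊ ⌊Real.exp (5 / 4 * L)⌋₊ with hS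
    set m : ℕ → ℝ := fun n => bump (5 / 4 - Real.log n / L) * selbergMajorant R n * n with hm
    have hm0 (n : ℕ) : 0 ≤ m n := mul_nonneg (mul_nonneg (bump_bounds _).1
      (selbergMajorant_nonneg R n)) (Nat.cast_nonneg n)
    have hsub : primeSegment P ⊆ S := by
      intro p hp
      obtain ⟨-, h1, h2⟩ := hmem p hp
      rw [hS, Finset.mem_Ioc, Nat.floor_lt (Real.exp_pos _).le]
      refine ⟨lt_of_lt_of_le ?_ h1, Nat.le_floor (h2.trans (Real.exp_le_exp.mpr (by linarith)))⟩
      rw [← hPL]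
      exact Real.exp_lt_exp.mpr (by linarith)
    -- For P ≤ p ≤ P^{6/5} one has u ∈ [1/20, 1/4], where the bump is at least 1, and p > R, so the
    -- majorant is 1.
    have hle : ∀ p ∈ primeSegment P, (p : ℝ) ≤ m p := by
      intro p hp
      obtain ⟨hpp, h1, h2⟩ := hmem p hp
      have hp0 : (0 : ℝ) < p := by exact_mod_cast hpp.pos
      have hRp : R < p := by
        rw [hR, Nat.floor_lt (Real.exp_pos _).le]
        refine lt_of_lt_of_le ?_ h1
        rw [← hPL]
        exact Real.exp_lt_exp.mpr (by linarith)
      have hR1 : 1 ≤ R := Nat.one_le_floor_iff _ |>.mpr (Real.one_le_exp (by positivity))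
      have hlog1 : L ≤ Real.log p := Real.log_le_log hP0 h1
      have hlog2 : Real.log p ≤ 6 / 5 * L := (Real.log_le_iff_le_exp hp0).mpr h2
      have hq1 : 1 ≤ Real.log p / L := by rwa [le_div_iff₀ hL0, one_mul]
      have hq2 : Real.log p / L ≤ 6 / 5 := by rwa [div_le_iff₀ hL0]
      have hb := (bump_bounds (5 / 4 - Real.log p / L)).2.2 (by linarith) (by linarith)
      simp only [hm, selbergMajorant_prime hR1 hpp hRp, mul_one]
      exact le_mul_of_one_le_left hp0.le hb
    calc ∑ p ∈ primeSegment P, (p : ℝ) * ‖∑ j, c j * x j p‖ ^ 2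
        ≤ ∑ p ∈ primeSegment P, m p * ‖∑ j, c j * x j p‖ ^ 2 := by
          gcongr with p hp
          exact hle p hp
      _ ≤ ∑ n ∈ S, m n * ‖∑ j, c j * x j n‖ ^ 2 :=
          Finset.sum_le_sum_of_subset_of_nonneg hsub fun n _ _ =>
            mul_nonneg (hm0 n) (by positivity)
      _ ≤ Δ * ∑ j, ‖c j‖ ^ 2 := by
          refine sum_mul_norm_sq_le_of_norm_gram_le S m x (B := fun j k =>
            1387 * ((1 + L * (2 - (ρ j).re - (ρ k).re))⁻¹ *
              (1 + (L * ((ρ k).im - (ρ j).im)) ^ 2)⁻¹) + C * (T * L ^ (-4 : ℤ))) ?_ ?_ ?_ c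
          · intro j k
            ring
          · intro j
            rw [Finset.sum_add_distrib, ← Finset.mul_sum, Finset.sum_const, Finset.card_univ,
              Fintype.card_fin, nsmul_eq_mul]
            -- Since 1 - β_j ≥ 0, dropping it enlarges each term; the height t = γ_j is admissible
            -- in V because |γ_j| ≤ T.
            have h1 : ∑ k, (1 + L * (2 - (ρ j).re - (ρ k).re))⁻¹ *
                (1 + (L * ((ρ k).im - (ρ j).im)) ^ 2)⁻¹ ≤ weightedCount ρ P (ρ j).im := by
              refine Finset.sum_le_sum fun k _ => ?_
              rw [← hLdef, mul_pow, mul_comm (L ^ 2)]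
              have hk : 0 ≤ 1 - (ρ k).re := by linarith [(hρ k).2.1]
              have hj : 0 ≤ 1 - (ρ j).re := by linarith [(hρ j).2.1]
              have h2 : (1 - (ρ k).re) * L ≤ L * (2 - (ρ j).re - (ρ k).re) := by nlinarith
              gcongr
            have h2 := h1.trans (hV _ (hρ j).2.2)
            rw [hΔ]
            linarith
          · intro j k
            have hz := hK L T hL hT (L * (2 - ρ j - (starRingEnd ℂ) (ρ k)))
            obtain ⟨hj0, hj1, hjT⟩ := hρ j
            obtain ⟨hk0, hk1, hkT⟩ := hρ k
            have hre : ((L : ℂ) * (2 - ρ j - (starRingEnd ℂ) (ρ k))).re =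
                L * (2 - (ρ j).re - (ρ k).re) := by simp
            have him : ((L : ℂ) * (2 - ρ j - (starRingEnd ℂ) (ρ k))).im =
                L * ((ρ k).im - (ρ j).im) := by
              simp only [Complex.im_ofReal_mul, Complex.sub_im, Complex.conj_im,
                Complex.im_ofNat]
              ring
            rw [hre, him] at hz
            have hz' := hz (by nlinarith) (by nlinarith) (by
              rw [abs_mul, abs_of_pos hL0]
              have := abs_sub (ρ k).im (ρ j).im
              nlinarith)
            refine le_of_eq_of_le ?_ hz'
            -- The phase depends on j and k but not on n, so it leaves the sum and has modulus 1.
            have hterm : ∀ n ∈ S, (m n : ℂ) * (x j n * (starRingEnd ℂ) (x k n)) =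
                Complex.exp (((5 / 4 * L * ((ρ k).im - (ρ j).im) : ℝ) : ℂ) * Complex.I) *
                  (bumpKernel L (L * (2 - ρ j - (starRingEnd ℂ) (ρ k))) n *
                    selbergMajorant R n) := by
              intro n hn
              have hn0 : n ≠ 0 := by have := (Finset.mem_Ioc.mp hn).1; omega
              rw [← mul_assoc (Complex.exp _),
                ← natCast_mul_cpow_mul_conj_eq_bumpKernel hL0.ne' hn0]
              simp only [hm, hx, Complex.ofReal_mul, Complex.ofReal_natCast]
              ring
            rw [Finset.sum_congr rfl hterm, ← Finset.mul_sum, norm_mul,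
              Complex.norm_exp_ofReal_mul_I, one_mul]
  have hfin := sum_norm_sq_le_of_dual (primeSegment P) x (fun p => (p : ℝ))
    (fun p hp => by exact_mod_cast (hmem p hp).1.pos) hΔ0 hdual a
  refine le_of_eq_of_le (Finset.sum_congr rfl fun j _ => ?_) hfin
  have h1 : ∑ p ∈ primeSegment P, a p * x j p =
      (Real.exp (5 / 4 * L * ((ρ j).re - 1)) : ℂ) *
        ∑ p ∈ primeSegment P, a p * (p : ℂ) ^ (-(ρ j)) := by
    rw [Finset.mul_sum]
    exact Finset.sum_congr rfl fun p _ => by simp only [hx]; ring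
  rw [h1, norm_mul, mul_pow, Complex.norm_real, Real.norm_of_nonneg (Real.exp_pos _).le, hPexp,
    ← Real.exp_nat_mul]
  congr 2
  push_cast
  ring
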